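/- Let $M$ be a lattice isometric to $A_2\oplus A_2(-1)^4$, with dual lattice $M'$. Then $M'/M$ has order $3^5$; for $\gamma,\delta\in M'/M$ the norm $\gamma^2$ is well defined mod $2$ and $(\gamma,\delta)$ is well defined mod $1$. Call $\gamma\in M'/M$ of type $00$ if $\gamma=0$, and of type $n\in\{0,1,2\}$ if $\gamma\neq0$ and $\gamma^2/2\equiv n/3 \bmod 1$; every nonzero $\gamma$ has exactly one of the types $0,1,2$. There is a unique representation $\rho_M$ of $SL_2(\mathbb Z)$ on $\mathbb C[M'/M]$ (the Weil representation), with basis $(e_\gamma)_{\gamma\in M'/M}$, such that for $T=\begin{pmatrix}1&1\\0&1\end{pmatrix}$ and $S=\begin{pmatrix}0&-1\\1&0\end{pmatrix}$ $$\rho_M(T)e_\gamma=e^{\pi i\gamma^2}e_\gamma,\qquad \rho_M(S)e_\delta=-i\,3^{-5/2}\sum_{\gamma\in M'/M}e^{-2\pi i(\delta,\gamma)}e_\gamma .$$ For $\tau$ in the upper half plane $\mathbb H$, with $\eta$ the Dedekind eta function and $q^r=e^{2\pi i r\tau}$, put $$f_{00}(\tau)=24\,\eta(3\tau)^3\eta(\tau)^{-9},\quad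 f_0(\tau)=-3\,\eta(3\tau)^3\eta(\tau)^{-9},\quad f_1(\tau)=0,\quad f_2(\tau)=\eta(\tau/3)^3\eta(\tau)^{-9}+3\,\eta(3\tau)^3\eta(\tau)^{-9},$$ and let $f=\sum_{\gamma\in M'/M}e_\gamma f_\gamma$, where $f_\gamma$ is the function $f_{00},f_0,f_1$ or $f_2$ belonging to the type of $\gamma$. Then $f$ is a modular form of weight $-3$ and type $\rho_M$ for $SL_2(\mathbb Z)$, holomorphic on $\mathbb H$ and meromorphic at the cusps. That is, every $f_\gamma$ is holomorphic on $\mathbb H$; $$f\Big(\frac{a\tau+b}{c\tau+d}\Big)=(c\tau+d)^{-3}\rho_M(g)f(\tau)\qquad\text{for all } g=\begin{pmatrix}a&b\\c&d\end{pmatrix}\in SL_2(\mathbb Z),\ \tau\in\mathbb H;$$ and for every such $g$ the components of $(c\tau+d)^{3}f(g\tau)$ are, near $i\infty$, meromorphic functions at $0$ of $q^{1/N}$ for some integer $N\ge1$. Moreover, as $\operatorname{Im}\tau\to\infty$, $$f_{00}=24\big(1+9q+54q^2+O(q^3)\big),\qquad f_0=-3+O(q),\qquad f_2=q^{-1/3}+14q^{2/3}+92q^{5/3}+O(q^{8/3}).$$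 -/

import Mathlib

open scoped MatrixGroups UpperHalfPlane Manifold
open Complex Asymptotics

noncomputable section

namespace CubicForm

/-! ### The lattice and its discriminant group -/

/-- The Gram matrix of `A₂ ⊕ A₂(-1) ⊕ A₂(-1) ⊕ A₂(-1) ⊕ A₂(-1)`; the first index of a pair
selects the summand and the second one a simple root of `A₂`. -/
def gram (i j : Fin 5 × Fin 2) : ℚ :=
  if i.1 = j.1 then
    (if i.1 = 0 then 1 else -1) * (!![2, -1; -1, 2] : Matrix (Fin 2) (Fin 2) ℚ) i.2 j.2
  else 0

variable {V : Type*} [AddCommGroup V] [Module ℚ V]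

/-- `M` is a lattice in the rational quadratic space `(V, B)`, with `M ⊗ ℚ = V`, isometric to
`A₂ ⊕ A₂(-1)⁴`: it has a `ℤ`-basis, which is a `ℚ`-basis of `V`, with the Gram matrix above. -/
def IsA2A2 (B : LinearMap.BilinForm ℚ V) (M : Submodule ℤ V) : Prop :=
  ∃ b : Module.Basis (Fin 5 × Fin 2) ℚ V,
    Submodule.span ℤ (Set.range b) = M ∧ ∀ i j, B (b i) (b j) = gram i j

/-- The discriminant group `M'/M`, where `M' = {x | (x, y) ∈ ℤ for all y ∈ M}`. -/
abbrev Disc (B : LinearMap.BilinForm ℚ V) (M : Submodule ℤ V) : Type _ :=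
  (B.dualSubmodule M) ⧸ M.submoduleOf (B.dualSubmodule M)

/-- The pairing `(γ, δ)` on `M'/M`, computed on chosen representatives in `M'`. Only its class
mod `1`, and that of `(γ, γ)` mod `2`, is meaningful; these do not depend on the representatives,
see `pairing_mk` and `pairing_self_mk`. -/
def pairing {B : LinearMap.BilinForm ℚ V} {M : Submodule ℤ V} (γ δ : Disc B M) : ℚ :=
  B (Quotient.out γ : B.dualSubmodule M) (Quotient.out δ : B.dualSubmodule M)

section WellDefined

variable {B : LinearMap.BilinForm ℚ V} {M : Submodule ℤ V}

theorem gram_comm (i j : Fin 5 × Fin 2) : gram i j = gram j i := by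
  obtain ⟨i, a⟩ := i
  obtain ⟨j, b⟩ := j
  unfold gram
  by_cases h : i = j
  · subst h
    fin_cases a <;> fin_cases b <;> simp
  · simp [h, Ne.symm h]

theorem IsA2A2.symm (h : IsA2A2 B M) (x y : V) : B x y = B y x := by
  obtain ⟨b, -, hb⟩ := h
  have : B = B.flip := by
    refine LinearMap.BilinForm.ext_basis b fun i j => ?_
    simp [hb, gram_comm i j]
  conv_lhs => rw [this]
  simp

theorem IsA2A2.even (h : IsA2A2 B M) :
    (∀ x ∈ M, ∀ y ∈ M, ∃ n : ℤ, B x y = n) ∧ ∀ x ∈ M, ∃ n : ℤ, B x x = 2 * n := by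
  have hs := h.symm
  obtain ⟨b, rfl, hb⟩ := h
  have hI : ∀ x ∈ Submodule.span ℤ (Set.range b), ∀ y ∈ Submodule.span ℤ (Set.range b),
      ∃ n : ℤ, B x y = n := by
    intro x hx y hy
    induction hx, hy using Submodule.span_induction₂ with
    | mem_mem x y hx hy =>
      obtain ⟨⟨i, a⟩, rfl⟩ := hx
      obtain ⟨⟨j, c⟩, rfl⟩ := hy
      rw [hb]
      refine ⟨if i = j then (if i = 0 then 1 else -1) *
        (!![2, -1; -1, 2] : Matrix (Fin 2) (Fin 2) ℤ) a c else 0, ?_⟩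
      unfold gram
      fin_cases a <;> fin_cases c <;> simp
    | zero_left y hy => exact ⟨0, by simp⟩
    | zero_right x hx => exact ⟨0, by simp⟩
    | add_left x y z _ _ _ h₁ h₂ =>
      obtain ⟨m, hm⟩ := h₁
      obtain ⟨n, hn⟩ := h₂
      exact ⟨m + n, by simp [hm, hn]⟩
    | add_right x y z _ _ _ h₁ h₂ =>
      obtain ⟨m, hm⟩ := h₁
      obtain ⟨n, hn⟩ := h₂
      exact ⟨m + n, by simp [hm, hn]⟩
    | smul_left r x y _ _ h₁ =>
      obtain ⟨m, hm⟩ := h₁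
      exact ⟨r * m, by simp [hm]⟩
    | smul_right r x y _ _ h₁ =>
      obtain ⟨m, hm⟩ := h₁
      exact ⟨r * m, by simp [hm]⟩
  refine ⟨hI, fun x hx => ?_⟩
  induction hx using Submodule.span_induction with
  | mem x hx =>
    obtain ⟨⟨i, a⟩, rfl⟩ := hx
    rw [hb]
    refine ⟨if i = 0 then 1 else -1, ?_⟩
    unfold gram
    fin_cases a <;> by_cases hi : i = 0 <;> simp [hi]
  | zero => exact ⟨0, by simp⟩
  | add x y hx hy h₁ h₂ =>
    obtain ⟨m, hm⟩ := h₁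
    obtain ⟨n, hn⟩ := h₂
    obtain ⟨k, hk⟩ := hI x hx y hy
    refine ⟨m + n + k, ?_⟩
    simp only [map_add, LinearMap.add_apply, hm, hn, hs y x, hk]
    push_cast
    ring
  | smul r x _ h₁ =>
    obtain ⟨m, hm⟩ := h₁
    refine ⟨r * r * m, ?_⟩
    simp [hm]
    ring

theorem exists_mem_mk_out (v : B.dualSubmodule M) :
    ∃ m ∈ M, ((Quotient.out (Submodule.Quotient.mk v : Disc B M) : B.dualSubmodule M) : V)
      = v + m := by
  have h : (Submodule.Quotient.mk (Quotient.out (Submodule.Quotient.mk v : Disc B M)) : Disc B M)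
      = Submodule.Quotient.mk v := Quotient.out_eq _
  rw [Submodule.Quotient.eq] at h
  exact ⟨_, h, by simp⟩

theorem exists_int_of_dual (v : B.dualSubmodule M) {m : V} (hm : m ∈ M) :
    ∃ n : ℤ, B v m = n := by
  obtain ⟨n, hn⟩ := Submodule.mem_one.mp (v.2 m hm)
  exact ⟨n, by simpa using hn.symm⟩

/-- `(γ, δ)` is well defined mod `1`. -/
theorem pairing_mk (h : IsA2A2 B M) (v w : B.dualSubmodule M) :
    ∃ n : ℤ, pairing (Submodule.Quotient.mk v : Disc B M) (Submodule.Quotient.mk w) =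
      B v w + n := by
  obtain ⟨m, hm, hv⟩ := exists_mem_mk_out v
  obtain ⟨k, hk, hw⟩ := exists_mem_mk_out w
  obtain ⟨a, ha⟩ := exists_int_of_dual v hk
  obtain ⟨c, hc⟩ := exists_int_of_dual w hm
  obtain ⟨d, hd⟩ := h.even.1 m hm k hk
  refine ⟨a + c + d, ?_⟩
  unfold pairing
  rw [hv, hw]
  simp only [map_add, LinearMap.add_apply, ha, h.symm m w, hc, hd]
  push_cast
  ring

/-- `γ²` is well defined mod `2`. -/
theorem pairing_self_mk (h : IsA2A2 B M) (v : B.dualSubmodule M) :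
    ∃ n : ℤ, pairing (Submodule.Quotient.mk v : Disc B M) (Submodule.Quotient.mk v) =
      B v v + 2 * n := by
  obtain ⟨m, hm, hv⟩ := exists_mem_mk_out v
  obtain ⟨a, ha⟩ := exists_int_of_dual v hm
  obtain ⟨d, hd⟩ := h.even.2 m hm
  refine ⟨a + d, ?_⟩
  unfold pairing
  rw [hv]
  simp only [map_add, LinearMap.add_apply, ha, h.symm m v, hd]
  push_cast
  ring

end WellDefined

/-- `γ` has type `n`: it is nonzero and `γ²/2 ≡ n/3 mod 1`. -/
def HasType {B : LinearMap.BilinForm ℚ V} {M : Submodule ℤ V} (γ : Disc B M) (n : ℕ) : Prop :=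
  γ ≠ 0 ∧ ∃ k : ℤ, pairing γ γ / 2 = n / 3 + k

/-! ### The Weil representation and modular forms -/

/-- `ρ` is the Weil representation `ρ_M` of `SL₂(ℤ)` on `ℂ[M'/M]`. A function `φ : M'/M → ℂ`
stands for the element `∑ φ(γ) e_γ` of `ℂ[M'/M]`, so that the formulas say
`ρ(T) e_γ = e^{πi γ²} e_γ` and `ρ(S) e_δ = -i 3^{-5/2} ∑_γ e^{-2πi (δ, γ)} e_γ`. As `S` and `T`
generate `SL₂(ℤ)`, they determine `ρ`. -/
def IsWeilRep {B : LinearMap.BilinForm ℚ V} {M : Submodule ℤ V}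
    (ρ : Representation ℂ SL(2, ℤ) (Disc B M → ℂ)) : Prop :=
  (∀ (φ : Disc B M → ℂ) (γ : Disc B M),
    ρ ModularGroup.T φ γ = exp (Real.pi * I * (pairing γ γ : ℚ)) * φ γ) ∧
  (∀ (φ : Disc B M → ℂ) (γ : Disc B M),
    ρ ModularGroup.S φ γ = -I * ((3 : ℝ) ^ (-(5 / 2) : ℝ) : ℝ) *
      ∑ᶠ δ : Disc B M, exp (-(2 * Real.pi * I * (pairing δ γ : ℚ))) * φ δ)

/-- `h` is meromorphic at `i∞`: near `i∞` it is a meromorphic function at `0` of the local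
parameter `q^{1/N} = e^{2πiτ/N}`, for some `N ≥ 1`. -/
def MeromorphicAtImInfty (h : ℍ → ℂ) : Prop :=
  ∃ N : ℕ, 0 < N ∧ ∃ F : ℂ → ℂ, MeromorphicAt F 0 ∧
    ∀ᶠ τ : ℍ in UpperHalfPlane.atImInfty, h τ = F (exp (2 * Real.pi * I * (τ : ℂ) / N))

/-- The automorphy factor `cτ + d`. -/
def autFactor (g : SL(2, ℤ)) (τ : ℍ) : ℂ := ((g 1 0 : ℤ) : ℂ) * (τ : ℂ) + ((g 1 1 : ℤ) : ℂ)

/-- `f = ∑ e_γ f_γ` is a modular form of weight `k` and type `ρ` for `SL₂(ℤ)`, holomorphic on the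
upper half plane and meromorphic at the cusps. The cusps are the points `g(i∞)` with
`g ∈ SL₂(ℤ)`. -/
structure IsModularFormOfType {D : Type*} (k : ℤ) (ρ : Representation ℂ SL(2, ℤ) (D → ℂ))
    (f : D → ℍ → ℂ) : Prop where
  holomorphic : ∀ γ, MDifferentiable 𝓘(ℂ) 𝓘(ℂ) (f γ)
  transform : ∀ (g : SL(2, ℤ)) (τ : ℍ) (γ : D),
    f γ (g • τ) = autFactor g τ ^ k * ρ g (fun δ => f δ τ) γ
  meromorphic : ∀ (g : SL(2, ℤ)) (γ : D),
    MeromorphicAtImInfty fun τ => autFactor g τ ^ (-k) * f γ (g • τ)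

/-! ### The form -/

/-- `f_{00} = 24 η(3τ)³ η(τ)⁻⁹` -/
def f00 (τ : ℍ) : ℂ := 24 * ModularForm.eta (3 * (τ : ℂ)) ^ 3 * ModularForm.eta (τ : ℂ) ^ (-9 : ℤ)

/-- `f_0 = -3 η(3τ)³ η(τ)⁻⁹` -/
def f0 (τ : ℍ) : ℂ := -3 * ModularForm.eta (3 * (τ : ℂ)) ^ 3 * ModularForm.eta (τ : ℂ) ^ (-9 : ℤ)

/-- `f_1 = 0` -/
def f1 (_ : ℍ) : ℂ := 0

/-- `f_2 = η(τ/3)³ η(τ)⁻⁹ + 3 η(3τ)³ η(τ)⁻⁹` -/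
def f2 (τ : ℍ) : ℂ :=
  ModularForm.eta ((τ : ℂ) / 3) ^ 3 * ModularForm.eta (τ : ℂ) ^ (-9 : ℤ) +
    3 * ModularForm.eta (3 * (τ : ℂ)) ^ 3 * ModularForm.eta (τ : ℂ) ^ (-9 : ℤ)

open Classical in
/-- The component `f_γ` is the function for the type of `γ` (every nonzero `γ` has exactly one of
the types `0`, `1`, `2`, so that the last branch is never reached). -/
def form (B : LinearMap.BilinForm ℚ V) (M : Submodule ℤ V) (γ : Disc B M) : ℍ → ℂ :=
  if γ = 0 then f00
  else if HasType γ 0 then f0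
  else if HasType γ 1 then f1
  else if HasType γ 2 then f2
  else 0

/-- `q^r = e^{2πi r τ}` -/
def qPow (r : ℝ) (τ : ℍ) : ℂ := exp (2 * Real.pi * I * r * (τ : ℂ))

end CubicForm

end

/-! Pairing with simple roots identifies `M'/M` with `𝔽₃⁵` so that `γ²/2 ≡ q(γ)/3 mod 1` for `q =
x₀² - x₁² - x₂² - x₃² - x₄²` (`exists_disc_equiv`). Orthogonality of characters and the Gauss sum of
`q` (collected in `IsDiscForm`) show that the prescribed operators satisfy `S⁴ = T³ = 1` and `(ST)³
= S²`. These are relations of `SL₂(𝔽₃)` strong enough to bring every word to Bruhat form, so the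
representation exists (`exists_weilRep`); it is unique because `S` and `T` generate.

Put `A = η(3τ)³η(τ)⁻⁹` and `B = η(τ/3)³η(τ)⁻⁹`. The component `f_γ` is a function of `q(γ)` with
values `-3A`, `0`, `B + 3A`, plus an extra `27A` at `γ = 0`. Modularity needs checking for `S` and
`T` only. The inversion formula of `η` exchanges `A` and `B` up to constants, and Gauss sums
transform functions of `q`; together they give `discComp_S`.

For `T` the point is that `B + 3A` has exponents in `-1/3 + ℤ` only. With `x = e^{2πiτ/3}` and `E(x)
= ∏(1 - xⁿ)`, it equals `x⁻¹ (E(x)³ + 3x E(x⁹)³) E(x³)⁻⁹`. Jacobi's identity expands `E(x)³` over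
triangular exponents. These are never `2 mod 3`, and the terms with exponent `1 mod 3` sum to `-3x
E(x⁹)³`, so only powers of `x³` survive (`hasSum_dissect`, `dissect_mul`).

Truncating Jacobi's series gives the expansions at `i∞`. The other cusps follow since `ρ(g)` only
forms linear combinations of the components. -/

namespace CubicForm

open Filter Topology Finset

/-! ### Jacobi's identity for the cube of the Euler product. -/

/-- The finite Euler product `(1 - x)(1 - x²)⋯(1 - xⁿ)`. -/
def eulerProd (x : ℂ) (n : ℕ) : ℂ := ∏ i ∈ range n, (1 - x ^ (i + 1))

/-- The Euler product `∏ (1 - xⁿ)`. -/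
noncomputable def euler (x : ℂ) : ℂ := ∏' n : ℕ, (1 - x ^ (n + 1))

theorem eulerProd_succ (x : ℂ) (n : ℕ) :
    eulerProd x (n + 1) = eulerProd x n * (1 - x ^ (n + 1)) := prod_range_succ _ _

theorem one_sub_pow_ne_zero {x : ℂ} (hx : ‖x‖ < 1) (n : ℕ) : 1 - x ^ (n + 1) ≠ 0 := by
  intro h
  have h1 : ‖x ^ (n + 1)‖ < 1 := by
    rw [norm_pow]
    exact pow_lt_one₀ (norm_nonneg _) hx (by simp)
  rw [← sub_eq_zero.mp h] at h1
  simp at h1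

theorem eulerProd_ne_zero {x : ℂ} (hx : ‖x‖ < 1) (n : ℕ) : eulerProd x n ≠ 0 :=
  prod_ne_zero_iff.mpr fun i _ => one_sub_pow_ne_zero hx i

theorem euler_ne_zero {x : ℂ} (hx : ‖x‖ < 1) : euler x ≠ 0 := by
  have h : Summable fun n : ℕ => ‖-x ^ (n + 1)‖ := by
    simpa [norm_pow] using (summable_nat_add_iff 1).mpr
      (summable_geometric_of_lt_one (norm_nonneg x) hx)
  have := tprod_one_add_ne_zero_of_summable
    (fun i => by simpa [sub_eq_add_neg] using one_sub_pow_ne_zero hx i) h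
  simpa only [euler, sub_eq_add_neg] using this

theorem tendsto_eulerProd {x : ℂ} (hx : ‖x‖ < 1) :
    Tendsto (eulerProd x) atTop (𝓝 (euler x)) :=
  (ModularForm.multipliable_one_sub_pow hx).tendsto_prod_tprod_nat

/-- The coefficients of the finite Jacobi triple product
`∏_{i ≤ n} (1 - z xⁱ) ∏_{i ≤ n} (1 - z⁻¹ xⁱ⁻¹)`. -/
noncomputable def tripleCoeff (x : ℂ) (n k : ℕ) : ℂ :=
  if k ≤ n then (-1) ^ k * x ^ (k * (k + 1) / 2) * eulerProd x (2 * n + 1) /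
    (eulerProd x (n - k) * eulerProd x (n + k + 1)) else 0

theorem triangle_succ (k : ℕ) : (k + 1) * (k + 1 + 1) / 2 = k * (k + 1) / 2 + (k + 1) := by
  rw [show (k + 1) * (k + 1 + 1) = k * (k + 1) + (k + 1) * 2 by ring,
    Nat.add_mul_div_right _ _ (by norm_num)]

theorem tripleCoeff_of_lt (x : ℂ) {n k : ℕ} (h : n < k) : tripleCoeff x n k = 0 := by
  simp [tripleCoeff, h]

/-- Passing from `n` to `n + 1` multiplies the finite product by `(1 - z x^{n+1})(1 - z⁻¹ x^{n+1})`;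
the recursions compare coefficients of `z^k`. The coefficients at `k` and `-1 - k` are opposite, so
`k ≥ 0` suffices, and the coefficient at `-1` supplies the extra middle term at `k = 0`. -/
theorem tripleCoeff_succ_zero {x : ℂ} (hx : ‖x‖ < 1) (n : ℕ) :
    tripleCoeff x (n + 1) 0 = (1 + x ^ (n + 1) + (x ^ (n + 1)) ^ 2) * tripleCoeff x n 0
      - x ^ (n + 1) * tripleCoeff x n 1 := by
  have hE := eulerProd_ne_zero hx
  have h1 := one_sub_pow_ne_zero hx
  rcases n with _ | n
  · simp [tripleCoeff, eulerProd, prod_range_succ]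
    have a := h1 0
    have b := h1 1
    have c := h1 2
    simp at a b c
    field_simp
    ring
  · have e1 := hE n
    have e2 := hE (n + 1 + 1)
    have a := h1 n
    have b := h1 (n + 1 + 1)
    have c := h1 (n + 1)
    simp only [tripleCoeff, Nat.le_add_left, if_true, Nat.sub_zero, Nat.add_sub_cancel,
      show 2 * (n + 1 + 1) + 1 = 2 * (n + 1) + 1 + 1 + 1 by ring,
      show 2 * (n + 1 ) + 1 = 2 * n + 1 + 1 + 1 by ring, eulerProd_succ, add_zero] at *
    simp only [zero_add, one_mul, zero_mul, Nat.reduceDiv, pow_zero, pow_one, Nat.reduceAdd] at *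
    field_simp
    ring

theorem tripleCoeff_succ_succ {x : ℂ} (hx : ‖x‖ < 1) (n k : ℕ) :
    tripleCoeff x (n + 1) (k + 1) = (1 + (x ^ (n + 1)) ^ 2) * tripleCoeff x n (k + 1)
      - x ^ (n + 1) * (tripleCoeff x n k + tripleCoeff x n (k + 2)) := by
  have hE := eulerProd_ne_zero hx
  have h1 := one_sub_pow_ne_zero hx
  rcases lt_trichotomy n k with h | rfl | h
  · simp [tripleCoeff_of_lt x h, tripleCoeff_of_lt x (show n + 1 < k + 1 by lia),
      tripleCoeff_of_lt x (show n < k + 1 by lia), tripleCoeff_of_lt x (show n < k + 2 by lia)]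
  · rw [tripleCoeff_of_lt x (show n < n + 1 by lia), tripleCoeff_of_lt x (show n < n + 2 by lia)]
    have e1 := hE (2 * n + 1)
    have a := h1 (2 * n + 1)
    have b := h1 (2 * n + 1 + 1)
    simp only [tripleCoeff, le_refl, if_true, Nat.sub_self,
      show 2 * (n + 1) + 1 = 2 * n + 1 + 1 + 1 by ring, triangle_succ,
      show n + 1 + (n + 1) + 1 = 2 * n + 1 + 1 + 1 by ring,
      show n + n + 1 = 2 * n + 1 by ring, eulerProd_succ]
    simp only [eulerProd, range_zero, prod_empty] at *
    field_simp
    ring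
  · obtain ⟨d, rfl⟩ := Nat.exists_eq_add_of_lt h
    have e1 := hE d
    have e2 := hE (2 * k + d + 1 + 1)
    have a := h1 d
    have b := h1 (2 * k + d + 1 + 1)
    have c := h1 (2 * k + d + 1 + 1 + 1)
    -- Here `n = k + d + 1`. For `d = 0` the index `k + 2` exceeds `n`, so the closed formula does
    -- not apply to it.
    rcases d with _ | d
    · rw [tripleCoeff_of_lt x (show k + 0 + 1 < k + 2 by lia)]
      simp only [tripleCoeff, show k + 0 + 1 + 1 - (k + 1) = 0 + 1 by lia,
        show k + 0 + 1 - (k + 1) = 0 by lia, show k + 0 + 1 - k = 0 + 1 by lia,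
        show k + 1 ≤ k + 0 + 1 + 1 by lia, show k + 1 ≤ k + 0 + 1 by lia,
        show k ≤ k + 0 + 1 by lia, if_true,
        show 2 * (k + 0 + 1 + 1) + 1 = 2 * k + 0 + 1 + 1 + 1 + 1 + 1 by ring,
        show 2 * (k + 0 + 1) + 1 = 2 * k + 0 + 1 + 1 + 1 by ring,
        show k + 0 + 1 + 1 + (k + 1) + 1 = 2 * k + 0 + 1 + 1 + 1 + 1 by ring,
        show k + 0 + 1 + (k + 1) + 1 = 2 * k + 0 + 1 + 1 + 1 by ring,
        show k + 0 + 1 + k + 1 = 2 * k + 0 + 1 + 1 by ring, triangle_succ, eulerProd_succ] at *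
      field_simp
      ring
    · have a' := h1 (d + 1)
      have a'' := h1 d
      have e1 := hE d
      have c' := h1 (2 * k + d + 1 + 1 + 1 + 1)
      simp only [tripleCoeff, show k + (d + 1) + 1 + 1 - (k + 1) = d + 1 + 1 by lia,
        show k + (d + 1) + 1 - (k + 1) = d + 1 by lia,
        show k + (d + 1) + 1 - k = d + 1 + 1 by lia,
        show k + (d + 1) + 1 - (k + 2) = d by lia,
        show k + 1 ≤ k + (d + 1) + 1 + 1 by lia, show k + 1 ≤ k + (d + 1) + 1 by lia,
        show k ≤ k + (d + 1) + 1 by lia, show k + 2 ≤ k + (d + 1) + 1 by lia, if_true,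
        show 2 * (k + (d + 1) + 1 + 1) + 1 = 2 * k + 2 * d + 5 + 1 + 1 by ring,
        show 2 * (k + (d + 1) + 1) + 1 = 2 * k + 2 * d + 5 by ring,
        show k + (d + 1) + 1 + 1 + (k + 1) + 1 = 2 * k + d + 1 + 1 + 1 + 1 + 1 by ring,
        show k + (d + 1) + 1 + (k + 1) + 1 = 2 * k + d + 1 + 1 + 1 + 1 by ring,
        show k + (d + 1) + 1 + (k + 2) + 1 = 2 * k + d + 1 + 1 + 1 + 1 + 1 by ring,
        show k + (d + 1) + 1 + k + 1 = 2 * k + d + 1 + 1 + 1 by ring,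
        show k + 2 = k + 1 + 1 by ring, triangle_succ,
        show 2 * k + (d + 1) = 2 * k + d + 1 by ring, eulerProd_succ] at *
      field_simp
      ring

/-- Divide the finite triple product by `1 - z⁻¹` and let `z → 1`: by antisymmetry the coefficients
come with `z^k - z^{-k-1}`, which contributes `2k + 1`. Algebraically, `(2k - 1) + (2k + 3) = 2(2k +
1)` turns the recursion into multiplication by `(1 - x^{n+1})²`. The bound `N` is left free because
the induction step uses two values of it. -/
theorem sum_tripleCoeff {x : ℂ} (hx : ‖x‖ < 1) (n : ℕ) :
    ∀ N, n < N → ∑ k ∈ range N, (2 * k + 1) * tripleCoeff x n k = eulerProd x n ^ 2 := by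
  induction n with
  | zero =>
    intro N hN
    rw [sum_eq_single_of_mem 0 (by simpa using hN)
      fun k _ hk => by rw [tripleCoeff_of_lt x (Nat.pos_of_ne_zero hk), mul_zero]]
    simp [tripleCoeff, eulerProd, div_self (show 1 - x ≠ 0 by simpa using one_sub_pow_ne_zero hx 0)]
  | succ n ih =>
    intro N hN
    obtain ⟨N, rfl⟩ : ∃ M, N = M + 1 := ⟨N - 1, by lia⟩
    have e0 := ih (N + 1) (by lia)
    have e1 := ih N (by lia)
    -- Summation by parts for arbitrary `N`; the boundary terms vanish once `n < N`.
    have key : ∀ N, ∑ k ∈ range (N + 1), (2 * k + 1) * tripleCoeff x (n + 1) k =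
        (1 + (x ^ (n + 1)) ^ 2) * ∑ k ∈ range (N + 1), (2 * k + 1) * tripleCoeff x n k
        - x ^ (n + 1) * (2 * (∑ k ∈ range N, (2 * k + 1) * tripleCoeff x n k)
          + (2 * N - 1) * tripleCoeff x n N + (2 * N + 1) * tripleCoeff x n (N + 1)) := by
      intro N
      induction N with
      | zero =>
        simp [tripleCoeff_succ_zero hx]
        ring
      | succ N ih =>
        rw [sum_range_succ, ih, sum_range_succ _ (N + 1), sum_range_succ _ N,
          tripleCoeff_succ_succ hx]
        push_cast
        ring
    rw [key, e0, e1, tripleCoeff_of_lt x (show n < N by lia),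
      tripleCoeff_of_lt x (show n < N + 1 by lia), eulerProd_succ]
    ring

theorem summable_jacobi_bound {r : ℝ} (h0 : 0 ≤ r) (h1 : r < 1) :
    Summable fun k : ℕ => (2 * k + 1 : ℝ) * r ^ (k * (k + 1) / 2) := by
  have hs : Summable fun k : ℕ => (2 * k + 1 : ℝ) * r ^ k := by
    have := ((summable_pow_mul_geometric_of_norm_lt_one 1 (by simpa [abs_of_nonneg h0] using h1 :
      ‖r‖ < 1)).mul_left 2).add (summable_geometric_of_lt_one h0 h1)
    refine this.congr fun k => ?_
    simp
    ring
  refine Summable.of_nonneg_of_le (fun k => by positivity) (fun k => ?_) hs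
  refine mul_le_mul_of_nonneg_left (pow_le_pow_of_le_one h0 h1.le ?_) (by positivity)
  rw [Nat.le_div_iff_mul_le (by norm_num)]
  rcases k with _ | k
  · simp
  · exact Nat.mul_le_mul_left _ (by lia)

/-- **Jacobi's identity** `∏ (1 - xⁿ)³ = ∑ (-1)ⁿ (2n + 1) x^{n(n+1)/2}`. -/
theorem hasSum_jacobi {x : ℂ} (hx : ‖x‖ < 1) :
    HasSum (fun k : ℕ => (-1) ^ k * (2 * k + 1) * x ^ (k * (k + 1) / 2)) (euler x ^ 3) := by
  have hE := tendsto_eulerProd hx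
  have hP := euler_ne_zero hx
  obtain ⟨C, hC⟩ := (Metric.isBounded_range_of_tendsto _ hE).exists_norm_le
  obtain ⟨D, hD⟩ := (Metric.isBounded_range_of_tendsto _ (hE.inv₀ hP)).exists_norm_le
  have hC' : ∀ n, ‖eulerProd x n‖ ≤ C := fun n => hC _ ⟨n, rfl⟩
  have hD' : ∀ n, ‖(eulerProd x n)⁻¹‖ ≤ D := fun n => hD _ ⟨n, rfl⟩
  have hC0 : 0 ≤ C := (norm_nonneg _).trans (hC' 0)
  have hD0 : 0 ≤ D := (norm_nonneg _).trans (hD' 0)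
  have hsum := summable_jacobi_bound (norm_nonneg x) hx
  have hb : Summable fun k : ℕ => (2 * k + 1 : ℝ) * ‖x‖ ^ (k * (k + 1) / 2) * (C * (D * D)) :=
    hsum.mul_right _
  have hn (k : ℕ) : ‖(2 * k + 1 : ℂ)‖ = 2 * k + 1 := by
    have : (2 * k + 1 : ℂ) = ((2 * k + 1 : ℕ) : ℂ) := by push_cast; rfl
    rw [this, Complex.norm_natCast]
    push_cast
    rfl
  -- As `n → ∞` the coefficients tend to `(-1)^k x^{k(k+1)/2} / E` and the sums to `E²`, where `E =
  -- euler x`. The quotient of Euler products is bounded by `C * (D * D)` uniformly in `n` and `k`.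
  have hlim := tendsto_tsum_of_dominated_convergence (𝓕 := atTop)
    (f := fun n k : ℕ => (2 * k + 1 : ℂ) * tripleCoeff x n k)
    (g := fun k : ℕ => (2 * k + 1 : ℂ) * ((-1) ^ k * x ^ (k * (k + 1) / 2) * euler x *
      ((euler x)⁻¹ * (euler x)⁻¹))) hb
    (fun k => by
      refine Tendsto.const_mul _ ?_
      have l1 : Tendsto (fun n : ℕ => eulerProd x (2 * n + 1)) atTop (𝓝 (euler x)) :=
        hE.comp (tendsto_atTop_mono (fun n => show n ≤ _ by lia) tendsto_id)
      have l2 : Tendsto (fun n : ℕ => eulerProd x (n - k)) atTop (𝓝 (euler x)) :=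
        hE.comp (tendsto_sub_atTop_nat k)
      have l3 : Tendsto (fun n : ℕ => eulerProd x (n + k + 1)) atTop (𝓝 (euler x)) :=
        hE.comp (tendsto_atTop_mono (fun n => show n ≤ _ by lia) tendsto_id)
      have := (l1.const_mul ((-1) ^ k * x ^ (k * (k + 1) / 2))).mul ((l2.inv₀ hP).mul (l3.inv₀ hP))
      refine this.congr' ?_
      filter_upwards [eventually_ge_atTop k] with n hn
      simp only [tripleCoeff, hn, if_true, div_eq_mul_inv, mul_inv])
    (Eventually.of_forall fun n k => by
      rw [norm_mul, hn, mul_assoc]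
      refine mul_le_mul_of_nonneg_left ?_ (by positivity)
      unfold tripleCoeff
      split_ifs
      · rw [div_eq_mul_inv, mul_inv, norm_mul, norm_mul, norm_mul, norm_mul, norm_pow, norm_pow,
          norm_neg, norm_one, one_pow, one_mul, mul_assoc]
        exact mul_le_mul_of_nonneg_left (mul_le_mul (hC' _) (mul_le_mul (hD' _) (hD' _)
          (norm_nonneg _) hD0) (by positivity) hC0) (by positivity)
      · rw [norm_zero]
        positivity)
  have hfin (n : ℕ) : ∑' k : ℕ, (2 * k + 1 : ℂ) * tripleCoeff x n k = eulerProd x n ^ 2 := by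
    rw [← sum_tripleCoeff hx n (n + 1) (by lia)]
    refine tsum_eq_sum fun k hk => ?_
    rw [tripleCoeff_of_lt x (by simpa using hk), mul_zero]
  simp_rw [hfin] at hlim
  have heq := tendsto_nhds_unique hlim (hE.pow 2)
  have hs : Summable fun k : ℕ => (-1) ^ k * (2 * k + 1 : ℂ) * x ^ (k * (k + 1) / 2) := by
    refine Summable.of_norm (hsum.congr fun k => ?_)
    simp [hn]
  convert hs.hasSum using 1
  rw [pow_succ, ← heq, ← tsum_mul_right]
  refine tsum_congr fun k => ?_
  field_simp

end CubicForm

namespace CubicForm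

/-! ### Homomorphisms from `SL₂(ℤ)` defined by the relations of `SL₂(𝔽₃)`. -/

section Presentation

variable {G : Type*} [Group G]

/-- The value at a matrix of `SL₂(𝔽₃)` of the homomorphism that sends the standard generators to
`s` and `t`, by the Bruhat decomposition: the matrix is `±Tⁿ` or `±Tᵃ S Tᵇ`. -/
def bruhatWord (s t : G) (m : Matrix (Fin 2) (Fin 2) (ZMod 3)) : G :=
  if m 1 0 = 0 then
    if m 0 0 = 1 then t ^ (m 0 1).val else s ^ 2 * t ^ (-(m 0 1)).val
  else if m 1 0 = 1 then t ^ (m 0 0).val * s * t ^ (m 1 1).val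
  else s ^ 2 * (t ^ (-(m 0 0)).val * s * t ^ (-(m 1 1)).val)

/-- Rewriting rules that lead to Bruhat form. The element `s² = (st)³` commutes with both `s` and
`st`, hence with `t`. Solving `(st)³ = s²` for `sts` gives the first rule, and inverting that one
gives the second. -/
theorem relation_sts {s t : G} (hs : s ^ 4 = 1) (ht : t ^ 3 = 1) (hst : (s * t) ^ 3 = s ^ 2) :
    s * t * s = t ^ 2 * s * t ^ 2 ∧ s * t ^ 2 * s = s ^ 2 * (t * s * t) ∧
      t * s ^ 2 = s ^ 2 * t := by
  have ht' : t ^ 2 = t⁻¹ := eq_inv_of_mul_eq_one_left (by rw [← pow_succ, ht])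
  have hs' : s ^ 2 * s ^ 2 = 1 := by rw [← pow_add, hs]
  have hc : Commute (s * t) (s ^ 2) := hst ▸ (Commute.refl (s * t)).pow_right 3
  have hcs : Commute s (s ^ 2) := (Commute.refl s).pow_right 2
  have hct : Commute t (s ^ 2) := by
    have := hcs.inv_left.mul_left hc
    simpa using this
  have h1 : s * t * s = t⁻¹ * s * t⁻¹ := by
    have : s * t * s * (t * s * t) = s ^ 2 := by
      rw [← hst]
      simp only [pow_succ, pow_zero, one_mul, mul_assoc]
    have h2 : s * t * s = s ^ 2 * (t⁻¹ * s⁻¹ * t⁻¹) := by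
      rw [← this]; group
    have h3 : s⁻¹ = s ^ 2 * s := by
      rw [← pow_succ]
      exact (eq_inv_of_mul_eq_one_left (by rw [← pow_succ, hs])).symm
    rw [h2, h3, ← mul_assoc t⁻¹, hct.inv_left.eq, mul_assoc, mul_assoc, ← mul_assoc, hs', one_mul,
      mul_assoc]
  refine ⟨by rw [ht', h1], ?_, hct⟩
  rw [ht']
  have h2 : s⁻¹ * t⁻¹ * s⁻¹ = t * s⁻¹ * t := by
    have := congrArg (·⁻¹) h1
    simpa [mul_assoc] using this
  have h3 : s⁻¹ = s ^ 2 * s := by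
    rw [← pow_succ]
    exact (eq_inv_of_mul_eq_one_left (by rw [← pow_succ, hs])).symm
  have h4 : s = s ^ 2 * s⁻¹ := by rw [pow_two]; group
  calc s * t⁻¹ * s = s ^ 2 * s⁻¹ * t⁻¹ * (s ^ 2 * s⁻¹) := by rw [← h4]
    _ = s ^ 2 * (s⁻¹ * t⁻¹ * s ^ 2 * s⁻¹) := by simp only [mul_assoc]
    _ = s ^ 2 * (s ^ 2 * (s⁻¹ * t⁻¹ * s⁻¹)) := by
      rw [mul_assoc s⁻¹, hct.inv_left.eq, ← mul_assoc s⁻¹, hcs.inv_left.eq]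
      simp only [mul_assoc]
    _ = s⁻¹ * t⁻¹ * s⁻¹ := by rw [← mul_assoc, hs', one_mul]
    _ = s ^ 2 * (t * s * t) := by
      rw [h2, h3, ← mul_assoc t, hct.eq]
      simp only [mul_assoc]

/-- The matrices on the left are `S m` and `T m`. With `z = s²` moved to the front and the inner
factors `s ⋯ s` collapsed, each of the 24 matrices of determinant one is settled by rewriting. -/
theorem bruhatWord_mul {s t : G} (hs : s ^ 4 = 1) (ht : t ^ 3 = 1) (hst : (s * t) ^ 3 = s ^ 2)
    (a b c d : ZMod 3) (h : a * d - b * c = 1) :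
    bruhatWord s t !![-c, -d; a, b] = s * bruhatWord s t !![a, b; c, d] ∧
    bruhatWord s t !![a + c, b + d; c, d] = t * bruhatWord s t !![a, b; c, d] := by
  obtain ⟨h1, h2, h3⟩ := relation_sts hs ht hst
  obtain ⟨z, hz⟩ : ∃ z, z = s ^ 2 := ⟨_, rfl⟩
  have ss : s * s = z := by rw [hz, pow_two]
  have sz : s * z = z * s := by rw [← ss, mul_assoc]
  have tz : t * z = z * t := by rw [hz, h3]
  have zz : z * z = 1 := by rw [hz, ← pow_add, hs]
  have ttt : t * (t * t) = 1 := by rw [← mul_assoc, ← pow_two, ← pow_succ, ht]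
  have sts : s * (t * s) = t * (t * (s * (t * t))) := by
    rw [← mul_assoc, h1]
    simp only [pow_two, mul_assoc]
  have stts : s * (t * (t * s)) = z * (t * (s * t)) := by
    rw [hz, ← mul_assoc t s t, ← h2]
    simp only [pow_two, mul_assoc]
  -- Products are kept right-associated, so each rule is also needed in front of a further factor.
  have left {u v : G} (h : u = v) (x : G) : u * x = v * x := by rw [h]
  have ss' := left ss
  have sz' := left sz
  have tz' := left tz
  have zz' := left zz
  have ttt' := left ttt
  have sts' := left sts
  have stts' := left stts
  simp only [mul_assoc, one_mul] at ss' sz' tz' zz' ttt' sts' stts'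
  clear h1 h2 h3 hs ht hst left
  have v0 : (0 : ZMod 3).val = 0 := rfl
  have v1 : (1 : ZMod 3).val = 1 := rfl
  have v2 : (2 : ZMod 3).val = 2 := rfl
  have n1 : (-1 : ZMod 3) = 2 := rfl
  have n2 : (-2 : ZMod 3) = 1 := rfl
  have n3 : (1 : ZMod 3) + 2 = 0 := rfl
  have n4 : (2 : ZMod 3) + 1 = 0 := rfl
  have n5 : (1 : ZMod 3) + 1 = 2 := rfl
  have n6 : (2 : ZMod 3) + 2 = 1 := rfl
  have n7 : ¬ (2 : ZMod 3) = 0 := by decide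
  have n8 : ¬ (1 : ZMod 3) = 0 := by decide
  have n9 : ¬ (2 : ZMod 3) = 1 := by decide
  have n10 : ¬ (0 : ZMod 3) = 1 := by decide
  have all : ∀ x : ZMod 3, x = 0 ∨ x = 1 ∨ x = 2 := by decide
  rcases all a with rfl | rfl | rfl <;> rcases all b with rfl | rfl | rfl <;>
    rcases all c with rfl | rfl | rfl <;> rcases all d with rfl | rfl | rfl <;>
    first
    | exact absurd h (by decide)
    | simp only [bruhatWord, Matrix.of_apply, Matrix.cons_val', Matrix.cons_val_zero,
        Matrix.cons_val_one, Matrix.cons_val_fin_one, neg_zero, n1, n2, n3, n4, n5, n6, n7, n8, n9,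
        n10, v0, v1, v2, if_true, if_false, add_zero, zero_add, ← hz, pow_zero, pow_one, pow_two,
        one_mul, mul_one, mul_assoc, ss, sz, tz, zz, ttt, sts, stts, ss', sz', tz', zz', ttt',
        sts', stts', and_self]

/-- `SL₂(ℤ)` acts through any pair of elements that satisfies the relations of the standard
generators of `SL₂(𝔽₃)`. -/
theorem exists_hom_SL2Z {s t : G} (hs : s ^ 4 = 1) (ht : t ^ 3 = 1) (hst : (s * t) ^ 3 = s ^ 2) :
    ∃ f : SL(2, ℤ) →* G, f ModularGroup.S = s ∧ f ModularGroup.T = t := by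
  let f : SL(2, ℤ) → G := fun g =>
    bruhatWord s t !![((g 0 0 : ℤ) : ZMod 3), ((g 0 1 : ℤ) : ZMod 3);
      ((g 1 0 : ℤ) : ZMod 3), ((g 1 1 : ℤ) : ZMod 3)]
  have hdet (g : SL(2, ℤ)) : ((g 0 0 : ℤ) : ZMod 3) * ((g 1 1 : ℤ) : ZMod 3) -
      ((g 0 1 : ℤ) : ZMod 3) * ((g 1 0 : ℤ) : ZMod 3) = 1 := by
    have := g.det_coe
    rw [Matrix.det_fin_two] at this
    exact_mod_cast congrArg (Int.cast : ℤ → ZMod 3) this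
  have fS (g : SL(2, ℤ)) : f (ModularGroup.S * g) = s * f g := by
    rw [← (bruhatWord_mul hs ht hst _ _ _ _ (hdet g)).1]
    simp [f, Matrix.SpecialLinearGroup.coe_mul, ModularGroup.coe_S, Matrix.mul_apply, Fin.sum_univ_two]
  have fT (g : SL(2, ℤ)) : f (ModularGroup.T * g) = t * f g := by
    rw [← (bruhatWord_mul hs ht hst _ _ _ _ (hdet g)).2]
    simp [f, Matrix.SpecialLinearGroup.coe_mul, ModularGroup.coe_T, Matrix.mul_apply, Fin.sum_univ_two]
  have f1 : f 1 = 1 := by simp [f, bruhatWord]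
  have fmul (g : SL(2, ℤ)) : ∀ h, f (g * h) = f g * f h := by
    have : g ∈ Subgroup.closure {ModularGroup.S, ModularGroup.T} := by
      simp [SpecialLinearGroup.SL2Z_generators]
    -- If left multiplication by `x` acts on the values of `f` through some `y`, evaluation at `1`
    -- forces `y = f x`.
    have aux {x : SL(2, ℤ)} {y : G} (hx : ∀ h, f (x * h) = y * f h) (h : SL(2, ℤ)) :
        f (x * h) = f x * f h := by
      have := hx 1
      rw [mul_one, f1, mul_one] at this
      rw [hx, this]
    induction this using Subgroup.closure_induction with
    | mem x hx =>
      rcases hx with rfl | rfl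
      · exact aux fS
      · exact aux fT
    | one => simp [f1]
    | mul x y _ _ h₁ h₂ =>
      intro h
      rw [mul_assoc, h₁, h₂, h₁, mul_assoc]
    | inv x _ h₁ =>
      refine aux (y := (f x)⁻¹) fun h => ?_
      rw [eq_inv_mul_iff_mul_eq, ← h₁, mul_inv_cancel_left]
  refine ⟨⟨⟨f, f1⟩, fun g h => fmul g h⟩, ?_, ?_⟩
  · simpa [f1] using fS 1
  · simpa [f1] using fT 1

end Presentation

end CubicForm

namespace CubicForm

/-! ### Quadratic forms over `ℤ/3` and their Gauss sums. -/

/-- The additive character `a ↦ e^{2πia/3}` of `ℤ/3`. -/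
noncomputable abbrev ψ : AddChar (ZMod 3) ℂ := ZMod.stdAddChar

/-- The number `i√3`, as a quadratic Gauss sum. -/
noncomputable def rootNegThree : ℂ := ψ 1 - ψ 2

theorem psi_cube (a : ZMod 3) : ψ a ^ 3 = 1 := by
  rw [← AddChar.map_nsmul_eq_pow]
  simp [show (3 : ZMod 3) = 0 from rfl]

theorem one_add_psi : 1 + ψ 1 + ψ 2 = 0 := by
  have h := AddChar.sum_eq_zero_of_ne_one (ψ := ψ) fun h => by
    have h1 : ψ 1 = ψ 0 := by rw [h]; simp
    exact absurd (ZMod.injective_stdAddChar h1) (by decide)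
  rw [show (Finset.univ : Finset (ZMod 3)) = {0, 1, 2} from rfl] at h
  rw [Finset.sum_insert (by decide), Finset.sum_insert (by decide), Finset.sum_singleton] at h
  rw [← h, AddChar.map_zero_eq_one]
  ring

theorem psi_two : ψ 2 = ψ 1 ^ 2 := by
  rw [← AddChar.map_nsmul_eq_pow]
  rfl

theorem rootNegThree_sq : rootNegThree ^ 2 = -3 := by
  have h1 := one_add_psi
  have h2 := psi_cube 1
  rw [rootNegThree, psi_two] at *
  linear_combination (ψ 1 - 2) * h2 + h1

theorem rootNegThree_eq : rootNegThree = I * (Real.sqrt 3 : ℝ) := by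
  have h1 : ψ 1 = exp (2 * Real.pi * I * (1 : ℤ) / (3 : ℕ)) := by
    rw [← ZMod.stdAddChar_coe]
    simp
  have h2 : ψ 1 = -(1 / 2 : ℝ) + (Real.sqrt 3 / 2 : ℝ) * I := by
    rw [h1, show 2 * Real.pi * I * (1 : ℤ) / (3 : ℕ) =
      ((Real.pi - Real.pi / 3 : ℝ) : ℂ) * I by push_cast; ring, exp_mul_I, ← ofReal_cos,
      ← ofReal_sin, Real.cos_pi_sub, Real.sin_pi_sub, Real.cos_pi_div_three,
      Real.sin_pi_div_three]
    push_cast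
    ring
  have h3 := one_add_psi
  rw [rootNegThree]
  push_cast at *
  linear_combination 2 * h2 - h3

theorem weil_const : -I * ((3 : ℝ) ^ (-(5 / 2) : ℝ) : ℝ) = -rootNegThree / 27 := by
  have : ((3 : ℝ) ^ (-(5 / 2) : ℝ)) = Real.sqrt 3 / 27 := by
    rw [show (-(5 / 2) : ℝ) = 1 / 2 - 3 by norm_num, Real.rpow_sub (by norm_num),
      Real.sqrt_eq_rpow]
    norm_num
  rw [this, rootNegThree_eq]
  push_cast
  ring

/-- `q` is a quadratic form on `D` with values in `ℤ/3` and bilinear form `b`, which is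
nondegenerate and has the Gauss sum of the discriminant form of `A₂ ⊕ A₂(-1)⁴`. -/
structure IsDiscForm {D : Type*} [AddCommGroup D] [Fintype D] [DecidableEq D]
    (q : D → ZMod 3) (b : D → D → ZMod 3) : Prop where
  q_add : ∀ x y, q (x + y) = q x + q y + b x y
  b_add : ∀ x y z, b x (y + z) = b x y + b x z
  b_comm : ∀ x y, b x y = b y x
  b_self : ∀ x, b x x = 2 * q x
  sum_b : ∀ y, ∑ x, ψ (b x y) = if y = 0 then 243 else 0
  gauss : ∑ x, ψ (q x) = 9 * rootNegThree

namespace IsDiscForm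

variable {D : Type*} [AddCommGroup D] [Fintype D] [DecidableEq D]
  {q : D → ZMod 3} {b : D → D → ZMod 3}

theorem b_zero (h : IsDiscForm q b) (x : D) : b x 0 = 0 := by simpa using h.b_add x 0 0

theorem b_neg (h : IsDiscForm q b) (x y : D) : b x (-y) = -b x y := by
  have := h.b_add x y (-y)
  rw [add_neg_cancel, h.b_zero] at this
  exact eq_neg_of_add_eq_zero_right this.symm

theorem b_add_left (h : IsDiscForm q b) (x y z : D) : b (x + y) z = b x z + b y z := by
  rw [h.b_comm, h.b_add, h.b_comm z x, h.b_comm z y]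

theorem b_sub_left (h : IsDiscForm q b) (x y z : D) : b (x - y) z = b x z - b y z := by
  rw [sub_eq_add_neg, h.b_comm, h.b_add, h.b_neg, h.b_comm z x, h.b_comm z y, sub_eq_add_neg]

theorem q_zero (h : IsDiscForm q b) : q 0 = 0 := by
  simpa [h.b_zero] using h.q_add 0 0

theorem q_neg (h : IsDiscForm q b) (x : D) : q (-x) = q x := by
  have := h.q_add x (-x)
  rw [add_neg_cancel, h.q_zero, h.b_neg, h.b_self] at this
  linear_combination -this

theorem q_sub (h : IsDiscForm q b) (x y : D) : q (x - y) = q x + q y - b x y := by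
  rw [sub_eq_add_neg, h.q_add, h.q_neg, h.b_neg, sub_eq_add_neg]

theorem gauss_neg (h : IsDiscForm q b) : ∑ x, ψ (-q x) = -9 * rootNegThree := by
  have := congrArg (starRingEnd ℂ) h.gauss
  simp only [map_sum, map_mul, rootNegThree, map_sub, ← AddChar.map_neg_eq_conj] at this
  rw [this, rootNegThree]
  simp only [show (-1 : ZMod 3) = 2 from rfl, show (-2 : ZMod 3) = 1 from rfl, map_ofNat]
  ring

/-- Completing the square: `q(x) - b(x, y) = q(x - y) - q(y)`. -/
theorem gauss_shift (h : IsDiscForm q b) (y : D) :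
    ∑ x, ψ (q x - b x y) = 9 * rootNegThree * ψ (-q y) := by
  rw [← h.gauss, Finset.sum_mul, ← Equiv.sum_comp (Equiv.addRight y)]
  refine Finset.sum_congr rfl fun x _ => ?_
  rw [← AddChar.map_add_eq_mul, Equiv.coe_addRight, h.q_add, h.b_add_left, h.b_self]
  ring_nf

theorem gauss_neg_shift (h : IsDiscForm q b) (y : D) :
    ∑ x, ψ (-q x - b x y) = -9 * rootNegThree * ψ (q y) := by
  rw [← h.gauss_neg, Finset.sum_mul, ← Equiv.sum_comp (Equiv.subRight y)]
  refine Finset.sum_congr rfl fun x _ => ?_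
  rw [← AddChar.map_add_eq_mul, Equiv.subRight_apply, h.q_sub, h.b_sub_left, h.b_self]
  ring_nf

end IsDiscForm

/-! ### The Weil representation of a discriminant form. -/

section Operators

variable {D : Type*} {q : D → ZMod 3} {b : D → D → ZMod 3}

/-- The action of `T` in the Weil representation. -/
noncomputable def opT (q : D → ZMod 3) : Module.End ℂ (D → ℂ) where
  toFun φ γ := ψ (q γ) * φ γ
  map_add' φ χ := by ext; simp [mul_add]
  map_smul' c φ := by ext; simp; ring

/-- The action of `S` in the Weil representation. -/
noncomputable def opS [Fintype D] (b : D → D → ZMod 3) : Module.End ℂ (D → ℂ) where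
  toFun φ γ := -rootNegThree / 27 * ∑ δ, ψ (-b δ γ) * φ δ
  map_add' φ χ := by ext; simp [mul_add, Finset.sum_add_distrib]
  map_smul' c φ := by
    ext
    simp only [Pi.smul_apply, smul_eq_mul, RingHom.id_apply, Finset.mul_sum]
    exact Finset.sum_congr rfl fun _ _ => by ring

theorem opT_apply (φ : D → ℂ) (γ : D) : opT q φ γ = ψ (q γ) * φ γ := rfl

theorem opS_apply [Fintype D] (φ : D → ℂ) (γ : D) :
    opS b φ γ = -rootNegThree / 27 * ∑ δ, ψ (-b δ γ) * φ δ := rfl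

theorem opT_cube : opT q ^ 3 = 1 := by
  refine LinearMap.ext fun φ => funext fun γ => ?_
  simp only [pow_succ, pow_zero, one_mul, Module.End.mul_apply, opT_apply, Module.End.one_apply]
  linear_combination φ γ * psi_cube (q γ)

variable [AddCommGroup D] [Fintype D] [DecidableEq D]

/-- Orthogonality of characters leaves only `ε = -γ`, with constant `(-i√3/27)² · 243 = -1`. -/
theorem opS_sq_apply (h : IsDiscForm q b) (φ : D → ℂ) (γ : D) :
    opS b (opS b φ) γ = -φ (-γ) := by
  have key (ε : D) : ∑ δ, ψ (-b δ γ) * (ψ (-b ε δ) * φ ε) = (if ε = -γ then 243 else 0) * φ ε := by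
    have := h.sum_b (-(γ + ε))
    simp only [neg_eq_zero, show γ + ε = 0 ↔ ε = -γ from add_comm γ ε ▸ add_eq_zero_iff_eq_neg]
      at this
    rw [← this, Finset.sum_mul]
    refine Finset.sum_congr rfl fun δ _ => ?_
    rw [← mul_assoc, ← AddChar.map_add_eq_mul, h.b_comm ε, h.b_neg, h.b_add]
    ring_nf
  simp only [opS_apply, Finset.mul_sum]
  rw [Finset.sum_comm]
  have (ε : D) : ∑ δ, -rootNegThree / 27 * (ψ (-b δ γ) * (-rootNegThree / 27 *
      (ψ (-b ε δ) * φ ε))) = (-rootNegThree / 27) ^ 2 * ((if ε = -γ then 243 else 0) * φ ε) := by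
    rw [← key, Finset.mul_sum]
    exact Finset.sum_congr rfl fun _ _ => by ring
  simp only [this, ite_mul, zero_mul, mul_ite, mul_zero, Finset.sum_ite_eq', Finset.mem_univ,
    if_true]
  linear_combination φ (-γ) * rootNegThree_sq / 3

theorem opS_pow_four (h : IsDiscForm q b) : opS b ^ 4 = 1 := by
  refine LinearMap.ext fun φ => funext fun γ => ?_
  simp only [pow_succ, pow_zero, one_mul, Module.End.mul_apply, Module.End.one_apply]
  rw [opS_sq_apply h, opS_sq_apply h, neg_neg, neg_neg]

/-- This is `STS = T⁻¹ST⁻¹`. The sum over the intermediate `δ` is a Gauss sum shifted by `ε + γ`,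
and `-q(ε + γ)` splits into the two diagonal factors and the kernel of `S`. -/
theorem opS_opT_opS_apply (h : IsDiscForm q b) (φ : D → ℂ) (γ : D) :
    opS b (opT q (opS b φ)) γ = ψ (-q γ) * opS b (fun ε => ψ (-q ε) * φ ε) γ := by
  simp only [opS_apply, opT_apply, Finset.mul_sum]
  rw [Finset.sum_comm]
  refine Finset.sum_congr rfl fun ε _ => ?_
  have : ∑ δ, ψ (-b δ γ) * ψ (q δ) * ψ (-b ε δ) =
      9 * rootNegThree * (ψ (-q γ) * ψ (-q ε) * ψ (-b ε γ)) := by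
    rw [← AddChar.map_add_eq_mul, ← AddChar.map_add_eq_mul,
      show -q γ + -q ε + -b ε γ = -q (ε + γ) by rw [h.q_add]; ring, ← h.gauss_shift]
    refine Finset.sum_congr rfl fun δ _ => ?_
    rw [← AddChar.map_add_eq_mul, ← AddChar.map_add_eq_mul, h.b_comm ε, h.b_add]
    ring_nf
  calc _ = (-rootNegThree / 27) ^ 2 * φ ε * ∑ δ, ψ (-b δ γ) * ψ (q δ) * ψ (-b ε δ) := by
        rw [Finset.mul_sum]
        exact Finset.sum_congr rfl fun _ _ => by ring
    _ = _ := by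
        rw [this]
        linear_combination rootNegThree / 81 * ψ (-q γ) * ψ (-q ε) * ψ (-b ε γ) * φ ε *
          rootNegThree_sq

/-- `(ST)³ = (STS)(TST) = T⁻¹S²T`, and `S²` commutes with `T` because `q` is even. -/
theorem opS_mul_opT_cube (h : IsDiscForm q b) : (opS b * opT q) ^ 3 = opS b ^ 2 := by
  refine LinearMap.ext fun φ => funext fun γ => ?_
  have e : (fun ε => ψ (-q ε) * opT q (opS b (opT q φ)) ε) = opS b (opT q φ) := by
    funext ε
    rw [opT_apply, ← mul_assoc, ← AddChar.map_add_eq_mul, neg_add_cancel,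
      AddChar.map_zero_eq_one, one_mul]
  simp only [pow_succ, pow_zero, one_mul, Module.End.mul_apply]
  rw [opS_opT_opS_apply h, e, opS_sq_apply h, opS_sq_apply h, opT_apply, h.q_neg, mul_neg,
    ← mul_assoc, ← AddChar.map_add_eq_mul, neg_add_cancel, AddChar.map_zero_eq_one, one_mul]

/-- The Weil representation of a discriminant form. -/
theorem exists_weilRep (h : IsDiscForm q b) :
    ∃ ρ : Representation ℂ SL(2, ℤ) (D → ℂ),
      ρ ModularGroup.S = opS b ∧ ρ ModularGroup.T = opT q := by
  obtain ⟨f, hS, hT⟩ := exists_hom_SL2Z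
    (s := Units.ofPowEqOne _ 4 (opS_pow_four h) (by norm_num))
    (t := Units.ofPowEqOne _ 3 (opT_cube (q := q)) (by norm_num))
    (by simp) (by simp)
    (by ext1; simpa using opS_mul_opT_cube h)
  exact ⟨(Units.coeHom _).comp f, by simp [hS], by simp [hT]⟩

theorem rep_ext {W : Type*} [AddCommGroup W] [Module ℂ W] {ρ σ : Representation ℂ SL(2, ℤ) W}
    (hS : ρ ModularGroup.S = σ ModularGroup.S) (hT : ρ ModularGroup.T = σ ModularGroup.T) :
    ρ = σ := by
  refine MonoidHom.eq_of_eqOn_dense SpecialLinearGroup.SL2Z_generators ?_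
  rintro x (rfl | rfl)
  · exact hS
  · exact hT

end Operators

end CubicForm

namespace CubicForm

/-! ### The model discriminant form on `(ℤ/3)⁵`. -/

/-- The signs of the summands of `A₂ ⊕ A₂(-1)⁴`. -/
def sgn (i : Fin 5) : ℤ := if i = 0 then 1 else -1

theorem sgn_mul_self (i : Fin 5) : sgn i * sgn i = 1 := by
  unfold sgn
  split_ifs <;> norm_num

/-- The quadratic form `γ²/2` on `(ℤ/3)⁵`, in units of `1/3`. -/
def stdQ (x : Fin 5 → ZMod 3) : ZMod 3 := ∑ i, (sgn i : ZMod 3) * x i ^ 2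

/-- The bilinear form of `stdQ`. -/
def stdB (x y : Fin 5 → ZMod 3) : ZMod 3 := ∑ i, 2 * (sgn i : ZMod 3) * (x i * y i)

theorem map_sum_psi (f : Fin 5 → ZMod 3) : ψ (∑ i, f i) = ∏ i, ψ (f i) := by
  simp only [Fin.sum_univ_five, Fin.prod_univ_five, AddChar.map_add_eq_mul]

theorem sum_psi_sum (f : Fin 5 → ZMod 3 → ZMod 3) :
    ∑ x : Fin 5 → ZMod 3, ψ (∑ i, f i (x i)) = ∏ i, ∑ a, ψ (f i a) := by
  rw [Finset.prod_univ_sum, Fintype.piFinset_univ]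
  exact Finset.sum_congr rfl fun x _ => map_sum_psi _

/-- Character sums factor over the five coordinates. Each coordinate contributes `3` or `0` to the
orthogonality relation and `±i√3` to the Gauss sum, whose value is `(i√3)(-i√3)⁴ = 9i√3`. -/
theorem isDiscForm_std : IsDiscForm stdQ stdB where
  q_add x y := by
    simp only [stdQ, stdB, ← Finset.sum_add_distrib, Pi.add_apply]
    exact Finset.sum_congr rfl fun _ _ => by ring
  b_add x y z := by
    simp only [stdB, ← Finset.sum_add_distrib, Pi.add_apply]
    exact Finset.sum_congr rfl fun _ _ => by ring
  b_comm x y := Finset.sum_congr rfl fun _ _ => by ring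
  b_self x := by
    simp only [stdQ, stdB, Finset.mul_sum]
    exact Finset.sum_congr rfl fun _ _ => by ring
  sum_b y := by
    have h (i : Fin 5) : ∑ a : ZMod 3, ψ (2 * (sgn i : ZMod 3) * (a * y i)) =
        if y i = 0 then 3 else 0 := by
      have h1 : (2 * (sgn i : ZMod 3) * y i = 0) ↔ y i = 0 := by
        generalize y i = u
        unfold sgn
        split_ifs <;> revert u <;> decide
      have := AddChar.sum_mulShift (2 * (sgn i : ZMod 3) * y i) (ZMod.isPrimitive_stdAddChar 3)
      rw [ZMod.card] at this
      simp only [h1] at this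
      refine Eq.trans (Finset.sum_congr rfl fun a _ => ?_) (this.trans (by norm_cast))
      ring_nf
    have h2 := sum_psi_sum fun i a => 2 * (sgn i : ZMod 3) * (a * y i)
    simp only [stdB, h2, h]
    split_ifs with hy
    · simp [hy]
      norm_num
    · obtain ⟨i, hi⟩ := Function.ne_iff.mp hy
      exact Finset.prod_eq_zero (Finset.mem_univ i) (if_neg hi)
  gauss := by
    have h2 := sum_psi_sum fun i a => (sgn i : ZMod 3) * a ^ 2
    have h3 : (Finset.univ : Finset (ZMod 3)) = {0, 1, 2} := rfl
    have h (i : Fin 5) : ∑ a : ZMod 3, ψ ((sgn i : ZMod 3) * a ^ 2) = sgn i * rootNegThree := by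
      rw [h3, Finset.sum_insert (by decide), Finset.sum_insert (by decide), Finset.sum_singleton]
      unfold sgn rootNegThree
      split_ifs
      · rw [show ((1 : ℤ) : ZMod 3) * 0 ^ 2 = 0 from rfl,
          show ((1 : ℤ) : ZMod 3) * 1 ^ 2 = 1 from rfl,
          show ((1 : ℤ) : ZMod 3) * 2 ^ 2 = 1 from rfl, AddChar.map_zero_eq_one]
        push_cast
        linear_combination one_add_psi
      · rw [show ((-1 : ℤ) : ZMod 3) * 0 ^ 2 = 0 from rfl,
          show ((-1 : ℤ) : ZMod 3) * 1 ^ 2 = 2 from rfl,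
          show ((-1 : ℤ) : ZMod 3) * 2 ^ 2 = 2 from rfl, AddChar.map_zero_eq_one]
        push_cast
        linear_combination one_add_psi
    simp only [stdQ, h2, h]
    rw [Fin.prod_univ_five]
    simp only [sgn, if_true, show ¬ (1 : Fin 5) = 0 by decide, show ¬ (2 : Fin 5) = 0 by decide,
      show ¬ (3 : Fin 5) = 0 by decide, show ¬ (4 : Fin 5) = 0 by decide, if_false]
    push_cast
    linear_combination (rootNegThree ^ 3 - 3 * rootNegThree) * rootNegThree_sq

theorem IsDiscForm.comp {D E : Type*} [AddCommGroup D] [Fintype D] [DecidableEq D]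
    [AddCommGroup E] [Fintype E] [DecidableEq E] {q : D → ZMod 3} {b : D → D → ZMod 3}
    (h : IsDiscForm q b) (e : E ≃+ D) : IsDiscForm (fun x => q (e x)) fun x y => b (e x) (e y) where
  q_add x y := by rw [map_add, h.q_add]
  b_add x y z := by rw [map_add, h.b_add]
  b_comm x y := h.b_comm _ _
  b_self x := h.b_self _
  sum_b y := by
    refine (e.toEquiv.sum_comp fun x => ψ (b x (e y))).trans ?_
    rw [h.sum_b]
    simp
  gauss := (e.toEquiv.sum_comp fun x => ψ (q x)).trans h.gauss

/-! ### The discriminant group of `A₂ ⊕ A₂(-1)⁴`. -/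

section Lattice

variable {V : Type*} [AddCommGroup V] [Module ℚ V] {B : LinearMap.BilinForm ℚ V}
  {M : Submodule ℤ V} {b : Module.Basis (Fin 5 × Fin 2) ℚ V}

theorem apply_basis (hb : ∀ i j, B (b i) (b j) = gram i j) (x : V) (i : Fin 5) :
    B x (b (i, 0)) = sgn i * (2 * b.repr x (i, 0) - b.repr x (i, 1)) ∧
    B x (b (i, 1)) = sgn i * (2 * b.repr x (i, 1) - b.repr x (i, 0)) := by
  have h (j) : B x (b j) = ∑ k, b.repr x k * gram k j := by
    conv_lhs => rw [← b.sum_repr x]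
    simp only [map_sum, LinearMap.sum_apply, map_smul, LinearMap.smul_apply, smul_eq_mul, hb]
  rw [h, h]
  simp only [Fintype.sum_prod_type, gram, ite_mul, mul_ite, mul_zero]
  constructor <;>
  · rw [Finset.sum_eq_single i (fun k _ hk => by simp [hk]) (by simp)]
    unfold sgn
    by_cases hi : i = 0 <;> simp [hi] <;> ring

/-- The inverse of the Gram matrix of `A₂` is `1/3` times the matrix with rows `(2, 1)` and `(1,
2)`; it expresses the form through the pairings with the basis. -/
theorem apply_eq_sum (hb : ∀ i j, B (b i) (b j) = gram i j) (x y : V) :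
    B x y = ∑ i, (sgn i : ℚ) * (2 * B x (b (i, 0)) * B y (b (i, 0)) +
      B x (b (i, 0)) * B y (b (i, 1)) + B x (b (i, 1)) * B y (b (i, 0)) +
      2 * B x (b (i, 1)) * B y (b (i, 1))) / 3 := by
  have h : B x y = ∑ k, b.repr y k * B x (b k) := by
    conv_lhs => rw [← b.sum_repr y]
    simp only [map_sum, map_smul, smul_eq_mul]
  rw [h, Fintype.sum_prod_type]
  refine Finset.sum_congr rfl fun i _ => ?_
  have hs : (sgn i : ℚ) * sgn i = 1 := mod_cast sgn_mul_self i
  rw [Fin.sum_univ_two, (apply_basis hb y i).1, (apply_basis hb y i).2]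
  linear_combination (-(b.repr y (i, 0) * B x (b (i, 0)) + b.repr y (i, 1) * B x (b (i, 1)))) * hs

theorem mem_dual_iff (hM : Submodule.span ℤ (Set.range b) = M) (x : V) :
    x ∈ B.dualSubmodule M ↔ ∀ j, ∃ n : ℤ, B x (b j) = n := by
  constructor
  · intro hx j
    exact exists_int_of_dual ⟨x, hx⟩ (hM ▸ Submodule.subset_span ⟨j, rfl⟩)
  · intro h y hy
    rw [← hM] at hy
    induction hy using Submodule.span_induction with
    | mem y hy =>
      obtain ⟨j, rfl⟩ := hy
      obtain ⟨n, hn⟩ := h j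
      exact Submodule.mem_one.mpr ⟨n, by simp [hn]⟩
    | zero => simp
    | add y z _ _ h₁ h₂ =>
      rw [map_add]
      exact add_mem h₁ h₂
    | smul r y _ h₁ =>
      rw [map_zsmul]
      exact Submodule.smul_mem _ r h₁

/-- The integer `(x, b_j)` for `x` in the dual lattice. -/
noncomputable def dualCoord (hM : Submodule.span ℤ (Set.range b) = M) (x : B.dualSubmodule M)
    (j : Fin 5 × Fin 2) : ℤ := ((mem_dual_iff hM x.1).mp x.2 j).choose

theorem dualCoord_spec (hM : Submodule.span ℤ (Set.range b) = M) (x : B.dualSubmodule M)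
    (j : Fin 5 × Fin 2) : B x (b j) = dualCoord hM x j :=
  ((mem_dual_iff hM x.1).mp x.2 j).choose_spec

/-- The map from the dual lattice to `(ℤ/3)⁵` with kernel `M`. -/
noncomputable def dualMap (hM : Submodule.span ℤ (Set.range b) = M) :
    B.dualSubmodule M →ₗ[ℤ] (Fin 5 → ZMod 3) :=
  AddMonoidHom.toIntLinearMap <| AddMonoidHom.mk'
    (fun x i => ((dualCoord hM x (i, 0) - dualCoord hM x (i, 1) : ℤ) : ZMod 3)) fun x y => by
      have h (j) : dualCoord hM (x + y) j = dualCoord hM x j + dualCoord hM y j := by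
        have := dualCoord_spec hM (x + y) j
        rw [Submodule.coe_add, map_add, LinearMap.add_apply, dualCoord_spec hM,
          dualCoord_spec hM] at this
        exact_mod_cast this.symm
      funext i
      simp only [h, Pi.add_apply]
      push_cast
      ring

theorem dualMap_apply (hM : Submodule.span ℤ (Set.range b) = M) (x : B.dualSubmodule M)
    (i : Fin 5) :
    dualMap hM x i = ((dualCoord hM x (i, 0) - dualCoord hM x (i, 1) : ℤ) : ZMod 3) := rfl

theorem dualMap_surjective (hM : Submodule.span ℤ (Set.range b) = M)
    (hb : ∀ i j, B (b i) (b j) = gram i j) : Function.Surjective (dualMap (B := B) hM) := by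
  intro v
  -- The coordinates `2/3, 1/3` are those of a fundamental weight of `A₂`, which pairs to `1` and
  -- `0` with the two simple roots; the sign compensates for `A₂(-1)`.
  let x : V := b.equivFun.symm fun j => sgn j.1 * (v j.1).val * (if j.2 = 0 then 2 / 3 else 1 / 3)
  have hx (j) : b.repr x j = sgn j.1 * (v j.1).val * (if j.2 = 0 then 2 / 3 else 1 / 3) := by
    rw [← b.equivFun_apply, LinearEquiv.apply_symm_apply]
  have hs (i) : (sgn i : ℚ) * sgn i = 1 := mod_cast sgn_mul_self i
  have h0 (i) : B x (b (i, 0)) = ((v i).val : ℤ) := by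
    rw [(apply_basis hb x i).1, hx, hx]
    simp only [if_true, if_neg (show ¬ (1 : Fin 2) = 0 by decide), Int.cast_natCast]
    linear_combination (v i).val * hs i
  have h1 (i) : B x (b (i, 1)) = (0 : ℤ) := by
    rw [(apply_basis hb x i).2, hx, hx]
    simp
    right
    ring
  have hmem : x ∈ B.dualSubmodule M := by
    rw [mem_dual_iff hM]
    rintro ⟨i, a⟩
    fin_cases a
    · exact ⟨_, h0 i⟩
    · exact ⟨_, h1 i⟩
  refine ⟨⟨x, hmem⟩, funext fun i => ?_⟩
  have e0 : dualCoord hM ⟨x, hmem⟩ (i, 0) = (v i).val := by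
    have := dualCoord_spec hM ⟨x, hmem⟩ (i, 0)
    rw [h0] at this
    exact_mod_cast this.symm
  have e1 : dualCoord hM ⟨x, hmem⟩ (i, 1) = 0 := by
    have := dualCoord_spec hM ⟨x, hmem⟩ (i, 1)
    rw [h1] at this
    exact_mod_cast this.symm
  rw [dualMap_apply, e0, e1]
  simp

theorem dualMap_ker (hM : Submodule.span ℤ (Set.range b) = M)
    (hb : ∀ i j, B (b i) (b j) = gram i j) :
    LinearMap.ker (dualMap (B := B) hM) = M.submoduleOf (B.dualSubmodule M) := by
  ext x
  have hs (i) : (sgn i : ℚ) * sgn i = 1 := mod_cast sgn_mul_self i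
  have hc (i) := apply_basis hb (x : V) i
  simp only [dualCoord_spec hM] at hc
  rw [LinearMap.mem_ker, Submodule.submoduleOf, Submodule.mem_comap, Submodule.subtype_apply]
  rw [show (x : V) ∈ M ↔ (x : V) ∈ Submodule.span ℤ (Set.range b) by rw [hM],
    b.mem_span_iff_repr_mem ℤ]
  constructor
  · rintro h ⟨i, a⟩
    have h' := congrFun h i
    rw [dualMap_apply, Pi.zero_apply, ZMod.intCast_zmod_eq_zero_iff_dvd _ 3] at h'
    obtain ⟨k, hk⟩ := h'
    have hk' : (dualCoord hM x (i, 0) : ℚ) - dualCoord hM x (i, 1) = 3 * k := by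
      exact_mod_cast hk
    obtain ⟨c0, c1⟩ := hc i
    -- Let `y₀, y₁` be the pairings with the two roots. If `y₀ - y₁ = 3k`, the coordinates `(2y₀ +
    -- y₁)/3` and `(y₀ + 2y₁)/3` are the integers `y₀ - k` and `y₁ + k`, up to the sign of the
    -- summand.
    fin_cases a
    · refine ⟨sgn i * (dualCoord hM x (i, 0) - k), ?_⟩
      simp
      linear_combination sgn i * c0 - sgn i / 3 * (c0 - c1 - hk') + (b.repr (x : V) (i, 0)) * hs i
    · refine ⟨sgn i * (dualCoord hM x (i, 1) + k), ?_⟩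
      simp
      linear_combination sgn i * c1 + sgn i / 3 * (c0 - c1 - hk') + (b.repr (x : V) (i, 1)) * hs i
  · intro h
    funext i
    rw [dualMap_apply, Pi.zero_apply, ZMod.intCast_zmod_eq_zero_iff_dvd _ 3]
    obtain ⟨m, hm⟩ := h (i, 0)
    obtain ⟨n, hn⟩ := h (i, 1)
    obtain ⟨c0, c1⟩ := hc i
    simp only [algebraMap_int_eq, eq_intCast] at hm hn
    rw [← hm, ← hn] at c0 c1
    refine ⟨sgn i * (m - n), ?_⟩
    have : (dualCoord hM x (i, 0) : ℚ) - dualCoord hM x (i, 1) = 3 * (sgn i * (m - n)) := by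
      rw [c0, c1]
      ring
    exact_mod_cast this

/-- The discriminant form of `A₂ ⊕ A₂(-1)⁴`. -/
theorem exists_disc_equiv (h : IsA2A2 B M) : ∃ e : Disc B M ≃+ (Fin 5 → ZMod 3),
    (∀ γ, ∃ m : ℤ, pairing γ γ / 2 = m / 3 ∧ (m : ZMod 3) = stdQ (e γ)) ∧
    ∀ γ δ, ∃ m : ℤ, pairing γ δ = m / 3 ∧ (m : ZMod 3) = stdB (e γ) (e δ) := by
  obtain ⟨b, hM, hb⟩ := h
  let f : Disc B M →ₗ[ℤ] (Fin 5 → ZMod 3) :=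
    (M.submoduleOf (B.dualSubmodule M)).liftQ (dualMap hM) (dualMap_ker hM hb).ge
  have hf : Function.Bijective f := by
    constructor
    · rw [← LinearMap.ker_eq_bot]
      exact Submodule.ker_liftQ_eq_bot _ _ _ (dualMap_ker hM hb).le
    · intro v
      obtain ⟨x, rfl⟩ := dualMap_surjective hM hb v
      exact ⟨Submodule.Quotient.mk x, rfl⟩
  have hout (γ : Disc B M) : f γ = dualMap hM (Quotient.out γ) := by
    conv_lhs => rw [← Quotient.out_eq γ]
    rfl
  have h3 : (3 : ZMod 3) = 0 := rfl
  refine ⟨(LinearEquiv.ofBijective f hf).toAddEquiv, fun γ => ?_, fun γ δ => ?_⟩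
  · let y := dualCoord hM (Quotient.out γ : B.dualSubmodule M)
    -- `y₀² + y₀y₁ + y₁² = (y₀ - y₁)² + 3y₀y₁`, so modulo `3` only `y₀ - y₁` matters.
    refine ⟨∑ i, sgn i * (y (i, 0) ^ 2 + y (i, 0) * y (i, 1) + y (i, 1) ^ 2), ?_, ?_⟩
    · rw [pairing, apply_eq_sum hb]
      simp only [dualCoord_spec hM]
      push_cast
      rw [Finset.sum_div, Finset.sum_div]
      exact Finset.sum_congr rfl fun i _ => by ring
    · change _ = stdQ (f γ)
      rw [hout, stdQ]
      push_cast
      refine Finset.sum_congr rfl fun i _ => ?_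
      rw [dualMap_apply]
      push_cast
      linear_combination (sgn i : ZMod 3) * (y (i, 0)) * (y (i, 1)) * h3
  · let y := dualCoord hM (Quotient.out γ : B.dualSubmodule M)
    let z := dualCoord hM (Quotient.out δ : B.dualSubmodule M)
    -- Since `1 ≡ -2 mod 3`, each summand is congruent to `2(y₀ - y₁)(z₀ - z₁)` up to its sign.
    refine ⟨∑ i, sgn i * (2 * y (i, 0) * z (i, 0) + y (i, 0) * z (i, 1) + y (i, 1) * z (i, 0) +
      2 * y (i, 1) * z (i, 1)), ?_, ?_⟩
    · rw [pairing, apply_eq_sum hb]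
      simp only [dualCoord_spec hM]
      push_cast
      rw [Finset.sum_div]
    · change _ = stdB (f γ) (f δ)
      rw [hout, hout, stdB]
      push_cast
      refine Finset.sum_congr rfl fun i _ => ?_
      rw [dualMap_apply, dualMap_apply]
      push_cast
      linear_combination (sgn i : ZMod 3) * (y (i, 0) * z (i, 1) + y (i, 1) * z (i, 0)) * h3

end Lattice

end CubicForm

namespace CubicForm

open Filter Topology

/-! ### The 3-dissection of the cube of the Euler product -/

/-- The terms of the cube of the Euler product whose exponent is divisible by `3`. -/
noncomputable def dissect (x : ℂ) : ℂ := euler x ^ 3 + 3 * x * euler (x ^ 9) ^ 3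

/-- For `k = 3m + 1` the triangular number is `9 · m(m+1)/2 + 1` and `2k + 1 = 3(2m + 1)`, so these
terms of Jacobi's series at `x` form `-3x` times the series at `x⁹`. -/
theorem hasSum_dissect {x : ℂ} (hx : ‖x‖ < 1) :
    HasSum (fun k : ℕ => if k % 3 = 1 then 0 else (-1) ^ k * (2 * k + 1) * x ^ (k * (k + 1) / 2))
      (dissect x) := by
  have hx9 : ‖x ^ 9‖ < 1 := by
    rw [norm_pow]
    exact pow_lt_one₀ (norm_nonneg _) hx (by norm_num)
  have h1 : HasSum (fun k : ℕ => if k % 3 = 1 then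
      (-1) ^ k * (2 * k + 1) * x ^ (k * (k + 1) / 2) else 0) (-(3 * x * euler (x ^ 9) ^ 3)) := by
    have hinj : Function.Injective fun m : ℕ => 3 * m + 1 := fun m n h => by simpa using h
    rw [← hinj.hasSum_iff]
    · have := (hasSum_jacobi hx9).mul_left (-(3 * x))
      rw [neg_mul] at this
      refine this.congr_fun fun m => ?_
      have ht : (3 * m + 1) * (3 * m + 1 + 1) / 2 = 9 * (m * (m + 1) / 2) + 1 := by
        have : 2 * (m * (m + 1) / 2) = m * (m + 1) :=
          Nat.mul_div_cancel' (Nat.even_mul_succ_self m).two_dvd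
        rw [Nat.div_eq_iff_eq_mul_left (by norm_num)
          (Nat.even_mul_succ_self (3 * m + 1)).two_dvd]
        linarith
      simp only [Function.comp, show (3 * m + 1) % 3 = 1 by lia, if_true]
      rw [ht, pow_succ (-1 : ℂ), pow_mul, pow_succ x, pow_mul x]
      push_cast
      norm_num
      ring
    · intro k hk
      refine if_neg fun h => hk ⟨k / 3, ?_⟩
      simp only
      lia
  have h2 := (hasSum_jacobi hx).sub h1
  rw [sub_neg_eq_add] at h2
  refine h2.congr_fun fun k => ?_
  split_ifs <;> ring

/-- For `k ≢ 1 mod 3` one of `k`, `k + 1` is divisible by `3`, so only powers of `x³` occur. -/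
theorem dissect_mul {w x : ℂ} (hw : w ^ 3 = 1) (hx : ‖x‖ < 1) : dissect (w * x) = dissect x := by
  have hw1 : ‖w‖ = 1 := norm_eq_one_of_pow_eq_one hw (by norm_num)
  have h := hasSum_dissect (x := w * x) (by rwa [norm_mul, hw1, one_mul])
  refine h.unique ((hasSum_dissect hx).congr_fun fun k => ?_)
  split_ifs with hk
  · rfl
  · obtain ⟨m, hm⟩ : 3 ∣ k * (k + 1) / 2 := by
      have h2 : k * (k + 1) / 2 * 2 = k * (k + 1) :=
        Nat.div_mul_cancel (Nat.even_mul_succ_self k).two_dvd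
      have : 3 ∣ k * (k + 1) / 2 * 2 := by
        rw [h2]
        rcases (show k % 3 = 0 ∨ (k + 1) % 3 = 0 by lia) with h | h
        · exact (Nat.dvd_of_mod_eq_zero h).mul_right _
        · exact (Nat.dvd_of_mod_eq_zero h).mul_left _
      exact (Nat.Coprime.dvd_of_dvd_mul_right (by norm_num) this)
    rw [mul_pow, hm, pow_mul w, hw, one_pow, one_mul]

/-! ### Expansions at `0` -/

/-- With `T(k) = k(k+1)/2` one has `T(k + N) = T(k) + T(N) + kN`. Hence `x^{T(N)}` factors out of
the tail of Jacobi's series, and the rest is bounded uniformly for `‖x‖ < 1/2`. -/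
theorem euler_cube_isBigO (N : ℕ) :
    (fun x : ℂ => euler x ^ 3 - ∑ k ∈ Finset.range N,
      (-1) ^ k * (2 * k + 1) * x ^ (k * (k + 1) / 2)) =O[𝓝 0] fun x => x ^ (N * (N + 1) / 2) := by
  have hs := (summable_jacobi_bound (r := 1 / 2) (by norm_num) (by norm_num)).mul_left (2 * N + 1 : ℝ)
  refine IsBigO.of_bound (∑' k : ℕ, (2 * N + 1 : ℝ) * ((2 * k + 1) * (1 / 2) ^ (k * (k + 1) / 2))) ?_
  filter_upwards [Metric.ball_mem_nhds (0 : ℂ) (by norm_num : (0 : ℝ) < 1 / 2)] with x hx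
  rw [mem_ball_zero_iff] at hx
  have hx1 : ‖x‖ < 1 := hx.trans (by norm_num)
  have hj := (hasSum_nat_add_iff' N).mpr (hasSum_jacobi hx1)
  have hle : ∀ k : ℕ, ‖(-1) ^ (k + N) * (2 * ((k + N : ℕ) : ℂ) + 1) *
      x ^ ((k + N) * (k + N + 1) / 2)‖ ≤
      (2 * N + 1 : ℝ) * ((2 * k + 1) * (1 / 2) ^ (k * (k + 1) / 2)) * ‖x‖ ^ (N * (N + 1) / 2) := by
    intro k
    have hT : (k + N) * (k + N + 1) / 2 = k * (k + 1) / 2 + N * (N + 1) / 2 + k * N := by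
      have h1 : 2 * (k * (k + 1) / 2) = k * (k + 1) :=
        Nat.mul_div_cancel' (Nat.even_mul_succ_self k).two_dvd
      have h2 : 2 * (N * (N + 1) / 2) = N * (N + 1) :=
        Nat.mul_div_cancel' (Nat.even_mul_succ_self N).two_dvd
      rw [Nat.div_eq_iff_eq_mul_left (by norm_num) (Nat.even_mul_succ_self (k + N)).two_dvd]
      linarith
    have hn : ‖(2 * ((k + N : ℕ) : ℂ) + 1)‖ = 2 * (k + N) + 1 := by
      have : (2 * ((k + N : ℕ) : ℂ) + 1) = ((2 * (k + N) + 1 : ℕ) : ℂ) := by push_cast; rfl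
      rw [this, Complex.norm_natCast]
      push_cast
      rfl
    rw [norm_mul, norm_mul, norm_pow, norm_neg, norm_one, one_pow, one_mul, hn, norm_pow, hT,
      pow_add, pow_add]
    have e1 : ‖x‖ ^ (k * (k + 1) / 2) ≤ (1 / 2) ^ (k * (k + 1) / 2) :=
      pow_le_pow_left₀ (norm_nonneg _) hx.le _
    have e2 : ‖x‖ ^ (k * N) ≤ 1 := pow_le_one₀ (norm_nonneg _) hx1.le
    have e3 : (2 * (k + N) + 1 : ℝ) ≤ (2 * N + 1) * (2 * k + 1) := by
      have : (0 : ℝ) ≤ N * k := by positivity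
      linarith
    calc (2 * (k + N) + 1 : ℝ) * (‖x‖ ^ (k * (k + 1) / 2) * ‖x‖ ^ (N * (N + 1) / 2) * ‖x‖ ^ (k * N))
        ≤ (2 * N + 1) * (2 * k + 1) * ((1 / 2) ^ (k * (k + 1) / 2) * ‖x‖ ^ (N * (N + 1) / 2) * 1) := by
          gcongr
      _ = _ := by ring
  rw [← hj.tsum_eq, norm_pow, ← tsum_mul_right]
  exact tsum_of_norm_bounded (hs.mul_right _).hasSum hle

theorem continuousAt_euler : ContinuousAt euler 0 :=
  (ModularForm.differentiableOn_tprod_one_sub_pow.differentiableAt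
    (Metric.ball_mem_nhds 0 one_pos)).continuousAt

theorem analyticAt_euler : AnalyticAt ℂ euler 0 :=
  ModularForm.differentiableOn_tprod_one_sub_pow.analyticAt (Metric.ball_mem_nhds 0 one_pos)

theorem euler_zero : euler 0 = 1 := by simp [euler]

theorem isBigO_continuous_mul {f g h : ℂ → ℂ} (hf : f =O[𝓝 0] h) (hg : ContinuousAt g 0) :
    (fun x => g x * f x) =O[𝓝 0] h := by
  simpa using (hg.isBigO_one ℂ).mul hf

/-- Jacobi gives `u = E(q)³ = 1 - 3q + O(q³)`. The term `h1` carries the error through the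
factorization of `u³ - (1 - 3q)³`. The term `h2` comes from `(1 - 3q)³(1 + 9q + 54q²) = 1 - q³(270 -
1215q + 1458q²)`. -/
theorem euler_inv_isBigO :
    (fun q : ℂ => (euler q ^ 9)⁻¹ - (1 + 9 * q + 54 * q ^ 2)) =O[𝓝 0] fun q => q ^ 3 := by
  have h := euler_cube_isBigO 2
  norm_num [Finset.sum_range_succ] at h
  have hne : ∀ᶠ q : ℂ in 𝓝 0, euler q ≠ 0 := by
    refine continuousAt_euler.eventually_ne ?_
    rw [euler_zero]
    exact one_ne_zero
  have hc := continuousAt_euler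
  have hci : ContinuousAt (fun q => (euler q ^ 9)⁻¹) 0 :=
    (hc.pow 9).inv₀ (by simp [euler_zero])
  have h1 := isBigO_continuous_mul h (g := fun q => -(euler q ^ 9)⁻¹ * (1 + 9 * q + 54 * q ^ 2) *
    (euler q ^ 6 + euler q ^ 3 * (1 - 3 * q) + (1 - 3 * q) ^ 2))
    (by fun_prop)
  have h2 := isBigO_continuous_mul (isBigO_refl (fun q : ℂ => q ^ 3) (𝓝 0))
    (g := fun q => (euler q ^ 9)⁻¹ * (270 - 1215 * q + 1458 * q ^ 2)) (by fun_prop)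
  refine (h1.add h2).congr' ?_ EventuallyEq.rfl
  filter_upwards [hne] with q hq
  field_simp
  ring

theorem euler_quot_isBigO :
    (fun q : ℂ => euler (q ^ 3) ^ 3 * (euler q ^ 9)⁻¹ - (1 + 9 * q + 54 * q ^ 2)) =O[𝓝 0]
      fun q => q ^ 3 := by
  have h := euler_cube_isBigO 1
  norm_num at h
  have ht : Tendsto (fun q : ℂ => q ^ 3) (𝓝 0) (𝓝 0) := by
    have : ContinuousAt (fun q : ℂ => q ^ 3) 0 := by fun_prop
    simpa [ContinuousAt] using this
  have h3 := h.comp_tendsto ht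
  have hci : ContinuousAt (fun q => (euler q ^ 9)⁻¹) 0 :=
    (continuousAt_euler.pow 9).inv₀ (by simp [euler_zero])
  refine ((isBigO_continuous_mul h3 hci).add euler_inv_isBigO).congr_left fun q => ?_
  simp only [Function.comp]
  ring

/-- The terms `∓3x` cancel, so `dissect x = 1 + 5x³ - 7x⁶ + O(x¹⁰)`. Multiplying by `1 + 9x³ + 54x⁶`
gives `14 = 9 + 5` and `92 = 54 + 45 - 7`, with remainder `207x⁹ - 378x¹²`, which is `a4`. -/
theorem dissect_isBigO :
    (fun x : ℂ => dissect x * (euler (x ^ 3) ^ 9)⁻¹ - (1 + 14 * x ^ 3 + 92 * x ^ 6)) =O[𝓝 0]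
      fun x => x ^ 9 := by
  have h := euler_cube_isBigO 1
  have h4 := euler_cube_isBigO 4
  norm_num [Finset.sum_range_succ] at h h4
  have ht (n : ℕ) (hn : n ≠ 0) : Tendsto (fun q : ℂ => q ^ n) (𝓝 0) (𝓝 0) := by
    have : ContinuousAt (fun q : ℂ => q ^ n) 0 := by fun_prop
    simpa [ContinuousAt, hn] using this
  have h9 := h.comp_tendsto (ht 9 (by norm_num))
  have hinv := euler_inv_isBigO.comp_tendsto (ht 3 (by norm_num))
  have h10 : (fun x : ℂ => x ^ 10) =O[𝓝 0] fun x : ℂ => x ^ 9 :=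
    (isBigO_continuous_mul (isBigO_refl (fun x : ℂ => x ^ 9) (𝓝 0))
      (g := fun x => x) continuousAt_id).congr_left fun x => by ring
  have hinv' : ((fun q : ℂ => (euler q ^ 9)⁻¹ - (1 + 9 * q + 54 * q ^ 2)) ∘ fun q : ℂ => q ^ 3)
      =O[𝓝 0] fun x : ℂ => x ^ 9 :=
    hinv.congr_right fun x => by simp only [Function.comp]; ring
  have hci : ContinuousAt (fun x : ℂ => (euler (x ^ 3) ^ 9)⁻¹) 0 := by
    have : ContinuousAt (fun x : ℂ => euler (x ^ 3)) 0 :=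
      ContinuousAt.comp (g := euler) (by simpa using continuousAt_euler) (by fun_prop)
    exact (this.pow 9).inv₀ (by simp [euler_zero])
  have a1 := isBigO_continuous_mul (h4.trans h10) hci
  have a2 := isBigO_continuous_mul h9 (g := fun x => 3 * x * (euler (x ^ 3) ^ 9)⁻¹) (by fun_prop)
  have a3 := isBigO_continuous_mul hinv' (g := fun x => 1 + 5 * x ^ 3 - 7 * x ^ 6) (by fun_prop)
  have a4 := isBigO_continuous_mul (isBigO_refl (fun x : ℂ => x ^ 9) (𝓝 0))
    (g := fun x => 207 - 378 * x ^ 3) (by fun_prop)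
  refine (((a1.add a2).add a3).add a4).congr_left fun x => ?_
  simp only [Function.comp, dissect]
  ring

end CubicForm

namespace CubicForm

open Filter Topology

/-! ### The eta quotients -/

/-- `η(3τ)³ η(τ)⁻⁹` -/
noncomputable def etaA (τ : ℍ) : ℂ :=
  ModularForm.eta (3 * (τ : ℂ)) ^ 3 * ModularForm.eta (τ : ℂ) ^ (-9 : ℤ)

/-- `η(τ/3)³ η(τ)⁻⁹` -/
noncomputable def etaB (τ : ℍ) : ℂ :=
  ModularForm.eta ((τ : ℂ) / 3) ^ 3 * ModularForm.eta (τ : ℂ) ^ (-9 : ℤ)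

/-- `e^{2πiτ/3}` -/
noncomputable def localParam (τ : ℍ) : ℂ := exp (2 * Real.pi * I * (τ : ℂ) / 3)

theorem localParam_ne_zero (τ : ℍ) : localParam τ ≠ 0 := exp_ne_zero _

theorem norm_localParam (τ : ℍ) : ‖localParam τ‖ < 1 := by
  have h := UpperHalfPlane.norm_qParam_lt_one 3 τ
  simpa [Function.Periodic.qParam, localParam] using h

theorem norm_localParam_pow (τ : ℍ) {n : ℕ} (hn : n ≠ 0) : ‖localParam τ ^ n‖ < 1 := by
  rw [norm_pow]
  exact pow_lt_one₀ (norm_nonneg _) (norm_localParam τ) hn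

theorem eta_eq (z : ℂ) : ModularForm.eta z =
    exp (2 * Real.pi * I * z / 24) * euler (exp (2 * Real.pi * I * z)) := by
  simp [ModularForm.eta, euler, ModularForm.eta_q, Function.Periodic.qParam]

theorem etaA_eq (τ : ℍ) : etaA τ =
    euler (localParam τ ^ 9) ^ 3 * (euler (localParam τ ^ 3) ^ 9)⁻¹ := by
  have h9 : exp (2 * Real.pi * I * (3 * (τ : ℂ))) = localParam τ ^ 9 := by
    rw [localParam, ← exp_nat_mul]
    push_cast
    ring_nf
  have h3 : exp (2 * Real.pi * I * (τ : ℂ)) = localParam τ ^ 3 := by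
    rw [localParam, ← exp_nat_mul]
    push_cast
    ring_nf
  have he : exp (2 * Real.pi * I * (3 * (τ : ℂ)) / 24) ^ 3 =
      exp (2 * Real.pi * I * (τ : ℂ) / 24) ^ 9 := by
    rw [← exp_nat_mul, ← exp_nat_mul]
    push_cast
    ring_nf
  rw [etaA, eta_eq, eta_eq, h9, h3, zpow_neg, mul_pow, he, show (9 : ℤ) = (9 : ℕ) from rfl,
    zpow_natCast, mul_pow]
  have := exp_ne_zero (2 * Real.pi * I * (τ : ℂ) / 24)
  have := euler_ne_zero (norm_localParam_pow τ (n := 3) (by norm_num))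
  field_simp

/-- The exponential prefactors of the eta functions leave `q^{1/24 - 9/24} = q^{-1/3}`, which is the
inverse of the local parameter. -/
theorem etaB_add_eq (τ : ℍ) : etaB τ + 3 * etaA τ =
    (localParam τ)⁻¹ * (dissect (localParam τ) * (euler (localParam τ ^ 3) ^ 9)⁻¹) := by
  have h1 : exp (2 * Real.pi * I * ((τ : ℂ) / 3)) = localParam τ := by
    rw [localParam]
    ring_nf
  have h3 : exp (2 * Real.pi * I * (τ : ℂ)) = localParam τ ^ 3 := by
    rw [localParam, ← exp_nat_mul]
    push_cast
    ring_nf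
  have he : exp (2 * Real.pi * I * (τ : ℂ) / 24) ^ 9 =
      localParam τ * exp (2 * Real.pi * I * ((τ : ℂ) / 3) / 24) ^ 3 := by
    rw [localParam, ← exp_nat_mul, ← exp_nat_mul, ← exp_add]
    push_cast
    ring_nf
  rw [etaA_eq, etaB, eta_eq, eta_eq, h1, h3, zpow_neg, mul_pow, show (9 : ℤ) = (9 : ℕ) from rfl,
    zpow_natCast, mul_pow, he, dissect]
  have := exp_ne_zero (2 * Real.pi * I * ((τ : ℂ) / 3) / 24)
  have := localParam_ne_zero τ
  have := euler_ne_zero (norm_localParam_pow τ (n := 3) (by norm_num))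
  field_simp

theorem localParam_T (τ : ℍ) : localParam (ModularGroup.T • τ) = ψ 1 * localParam τ := by
  have h1 : ψ 1 = exp (2 * Real.pi * I * (1 : ℤ) / (3 : ℕ)) := by
    rw [← ZMod.stdAddChar_coe]
    simp
  rw [h1, localParam, localParam, UpperHalfPlane.modular_T_smul, UpperHalfPlane.coe_vadd, ← exp_add]
  push_cast
  ring_nf

theorem etaA_T (τ : ℍ) : etaA (ModularGroup.T • τ) = etaA τ := by
  have h := psi_cube 1
  rw [etaA_eq, etaA_eq, localParam_T, mul_pow, mul_pow, h, show ψ 1 ^ 9 = (ψ 1 ^ 3) ^ 3 by ring, h,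
    one_pow, one_mul, one_mul]

/-- Only the factor `x⁻¹` changes, since the dissected series is invariant. The eigenvalue `ψ 2` is
the one `T` has on vectors of type `2`. -/
theorem etaB_add_T (τ : ℍ) : etaB (ModularGroup.T • τ) + 3 * etaA (ModularGroup.T • τ) =
    ψ 2 * (etaB τ + 3 * etaA τ) := by
  have h := psi_cube 1
  have h1 : ψ 1 ≠ 0 := fun h0 => by simp [h0] at h
  have h2 : (ψ 1)⁻¹ = ψ 2 := by
    rw [psi_two]
    field_simp
    exact h.symm
  rw [etaB_add_eq, etaB_add_eq, localParam_T, dissect_mul h (norm_localParam τ), mul_pow, h, one_mul,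
    mul_inv, h2]
  ring

theorem eta_neg_one_div {z : ℂ} (hz : 0 < z.im) :
    ModularForm.eta (-1 / z) = (Complex.sqrt I)⁻¹ * (Complex.sqrt z * ModularForm.eta z) :=
  ModularForm.eta_comp_eq_csqrt_I_inv hz

theorem csqrt_sq (z : ℂ) (hz : z ≠ 0) : Complex.sqrt z ^ 2 = z := by
  rw [sqrt_eq_exp hz, ← exp_nat_mul, show ((2 : ℕ) : ℂ) * (log z / 2) = log z by push_cast; ring,
    exp_log hz]

theorem csqrt_ofReal_mul {r : ℝ} (hr : 0 < r) {z : ℂ} (hz : z ≠ 0) :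
    Complex.sqrt (r * z) = (Real.sqrt r : ℝ) * Complex.sqrt z := by
  rw [sqrt_eq_exp hz, sqrt_eq_exp (mul_ne_zero (ofReal_ne_zero.mpr hr.ne') hz),
    log_ofReal_mul hr hz, add_div, exp_add]
  congr 1
  rw [Real.sqrt_eq_rpow, Real.rpow_def_of_pos hr]
  push_cast
  ring_nf

theorem sqrt_three_cube : ((Real.sqrt 3 : ℝ) : ℂ) ^ 3 = -3 * I * rootNegThree := by
  have h : ((Real.sqrt 3 : ℝ) : ℂ) ^ 2 = 3 := by
    rw [← ofReal_pow, Real.sq_sqrt (by norm_num)]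
    norm_num
  rw [rootNegThree_eq]
  linear_combination ((Real.sqrt 3 : ℝ) : ℂ) * h + 3 * ((Real.sqrt 3 : ℝ) : ℂ) * I_sq

theorem sqrt_quot_pow (τ : ℍ) :
    ((Complex.sqrt I)⁻¹ * Complex.sqrt (τ : ℂ)) ^ 6 = I * (τ : ℂ) ^ 3 := by
  rw [mul_pow, inv_pow, show (6 : ℕ) = 2 * 3 from rfl, pow_mul, pow_mul, csqrt_sq _ I_ne_zero,
    csqrt_sq _ τ.ne_zero, I_pow_three, inv_neg, inv_I, neg_neg]

theorem coe_S_smul (τ : ℍ) : ((ModularGroup.S • τ : ℍ) : ℂ) = -1 / (τ : ℂ) := by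
  rw [UpperHalfPlane.modular_S_smul, UpperHalfPlane.coe_mk]
  rw [inv_neg, neg_div, one_div]

/-- The triple of `-1/τ` is `-1/(τ/3)`, so inversion applies to both eta functions. Their
multipliers `k` at `τ/3` and `j` at `τ` satisfy `j = √3 k` on the principal branch and `j⁶ = iτ³`,
which determines `k³j⁻⁹` without further choice of roots. -/
theorem etaA_S (τ : ℍ) : etaA (ModularGroup.S • τ) =
    ((τ : ℂ) ^ 3)⁻¹ * (-rootNegThree / 9 * etaB τ) := by
  have hτ := τ.ne_zero
  have him : 0 < ((τ : ℂ) / 3).im := by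
    rw [show (τ : ℂ) / 3 = ((1 / 3 : ℝ) : ℂ) * τ by push_cast; ring, im_ofReal_mul]
    exact mul_pos (by norm_num) τ.im_pos
  have e1 : 3 * (-1 / (τ : ℂ)) = -1 / ((τ : ℂ) / 3) := by field_simp
  have e2 : Complex.sqrt (τ : ℂ) = (Real.sqrt 3 : ℝ) * Complex.sqrt ((τ : ℂ) / 3) := by
    rw [← csqrt_ofReal_mul (by norm_num) (div_ne_zero hτ three_ne_zero)]
    congr 1
    push_cast
    field_simp
  have h6 := sqrt_quot_pow τ
  have h3 := sqrt_three_cube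
  have hr := rootNegThree_sq
  rw [etaA, etaB, coe_S_smul, e1, eta_neg_one_div him, eta_neg_one_div τ.im_pos, zpow_neg, zpow_neg,
    show (9 : ℤ) = (9 : ℕ) from rfl, zpow_natCast, zpow_natCast]
  set j := (Complex.sqrt I)⁻¹ * Complex.sqrt (τ : ℂ) with hj
  set k := (Complex.sqrt I)⁻¹ * Complex.sqrt ((τ : ℂ) / 3) with hk
  have hjk : j = (Real.sqrt 3 : ℝ) * k := by rw [hj, hk, e2]; ring
  have hj0 : j ≠ 0 := fun h0 => by
    rw [h0] at h6
    simp [hτ] at h6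
  have hjk3 : j ^ 3 = -3 * I * rootNegThree * k ^ 3 := by rw [hjk, mul_pow, h3]
  have hk3 : k ^ 3 = -I * rootNegThree / 9 * j ^ 3 := by
    rw [hjk3]
    linear_combination (-k ^ 3 / 3) * I ^ 2 * hr + k ^ 3 * I_sq
  have hk6 : k ^ 3 * (j ^ 9)⁻¹ = -rootNegThree / 9 * ((τ : ℂ) ^ 3)⁻¹ := by
    rw [hk3, show j ^ 9 = j ^ 3 * j ^ 6 by ring, h6]
    field_simp
  rw [← mul_assoc (Complex.sqrt I)⁻¹, ← mul_assoc (Complex.sqrt I)⁻¹, ← hj, ← hk, mul_pow k,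
    mul_pow j, mul_inv]
  linear_combination ModularForm.eta ((τ : ℂ) / 3) ^ 3 * (ModularForm.eta (τ : ℂ) ^ 9)⁻¹ * hk6

theorem etaB_S (τ : ℍ) : etaB (ModularGroup.S • τ) =
    ((τ : ℂ) ^ 3)⁻¹ * (-3 * rootNegThree * etaA τ) := by
  have hτ := τ.ne_zero
  have him : 0 < (3 * (τ : ℂ)).im := by
    rw [show 3 * (τ : ℂ) = ((3 : ℝ) : ℂ) * τ by push_cast; ring, im_ofReal_mul]
    exact mul_pos (by norm_num) τ.im_pos
  have e1 : -1 / (τ : ℂ) / 3 = -1 / (3 * (τ : ℂ)) := by field_simp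
  have e2 : Complex.sqrt (3 * (τ : ℂ)) = (Real.sqrt 3 : ℝ) * Complex.sqrt (τ : ℂ) := by
    rw [← csqrt_ofReal_mul (by norm_num) hτ]
    norm_num
  have h6 := sqrt_quot_pow τ
  have h3 := sqrt_three_cube
  rw [etaA, etaB, coe_S_smul, e1, eta_neg_one_div him, eta_neg_one_div τ.im_pos, zpow_neg, zpow_neg,
    show (9 : ℤ) = (9 : ℕ) from rfl, zpow_natCast, zpow_natCast, e2]
  set j := (Complex.sqrt I)⁻¹ * Complex.sqrt (τ : ℂ) with hj
  have hj0 : j ≠ 0 := fun h0 => by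
    rw [h0] at h6
    simp [hτ] at h6
  have hk6 : ((Real.sqrt 3 : ℝ) * j) ^ 3 * (j ^ 9)⁻¹ = -3 * rootNegThree * ((τ : ℂ) ^ 3)⁻¹ := by
    rw [mul_pow, h3, show j ^ 9 = j ^ 3 * j ^ 6 by ring, h6]
    field_simp
  rw [show (Complex.sqrt I)⁻¹ * ((Real.sqrt 3 : ℝ) * Complex.sqrt (τ : ℂ) *
    ModularForm.eta (3 * (τ : ℂ))) = (Real.sqrt 3 : ℝ) * j * ModularForm.eta (3 * (τ : ℂ)) by
    rw [hj]; ring, ← mul_assoc (Complex.sqrt I)⁻¹, ← hj, mul_pow _ (ModularForm.eta _), mul_pow j,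
    mul_inv]
  linear_combination ModularForm.eta (3 * (τ : ℂ)) ^ 3 * (ModularForm.eta (τ : ℂ) ^ 9)⁻¹ * hk6

/-! ### The vector-valued form -/

/-- The component of the form at a vector of type `n`, apart from the correction at `0`. -/
noncomputable def typeComp (n : ZMod 3) (τ : ℍ) : ℂ :=
  if n = 0 then -3 * etaA τ else if n = 1 then 0 else etaB τ + 3 * etaA τ

theorem zmod3_cases (a : ZMod 3) : a = 0 ∨ a = 1 ∨ a = 2 := by
  revert a
  decide

theorem typeComp_zero (τ : ℍ) : typeComp 0 τ = -3 * etaA τ := if_pos rfl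

theorem typeComp_one (τ : ℍ) : typeComp 1 τ = 0 := by
  rw [typeComp, if_neg (by decide), if_pos rfl]

theorem typeComp_two (τ : ℍ) : typeComp 2 τ = etaB τ + 3 * etaA τ := by
  rw [typeComp, if_neg (by decide), if_neg (by decide)]

section Transform

variable {D : Type*} [AddCommGroup D] [DecidableEq D]

/-- The form as a function of the discriminant form. -/
noncomputable def discComp (q : D → ZMod 3) (γ : D) (τ : ℍ) : ℂ :=
  (if γ = 0 then 27 * etaA τ else 0) + typeComp (q γ) τ

variable [Fintype D] {q : D → ZMod 3} {b : D → D → ZMod 3}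

theorem discComp_T (h : IsDiscForm q b) (γ : D) (τ : ℍ) :
    discComp q γ (ModularGroup.T • τ) = opT q (fun δ => discComp q δ τ) γ := by
  rw [opT_apply, discComp, discComp, mul_add]
  congr 1
  · split_ifs with hγ
    · rw [hγ, h.q_zero, AddChar.map_zero_eq_one, one_mul, etaA_T]
    · rw [mul_zero]
  · rcases zmod3_cases (q γ) with h | h | h <;> rw [h]
    · rw [typeComp_zero, typeComp_zero, AddChar.map_zero_eq_one, one_mul, etaA_T]
    · rw [typeComp_one, typeComp_one, mul_zero]
    · rw [typeComp_two, typeComp_two, etaB_add_T]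

theorem discComp_S (h : IsDiscForm q b) (γ : D) (τ : ℍ) :
    discComp q γ (ModularGroup.S • τ) =
      ((τ : ℂ) ^ 3)⁻¹ * opS b (fun δ => discComp q δ τ) γ := by
  have p1 := one_add_psi
  have p2 := psi_two
  have p3 := psi_cube 1
  have hr : rootNegThree = ψ 1 - ψ 2 := rfl
  have hr2 := rootNegThree_sq
  have n1 : (-1 : ZMod 3) = 2 := rfl
  have n2 : (-2 : ZMod 3) = 1 := rfl
  -- Fourier expansion on `ℤ/3`. Under `S` the constant becomes a multiple of the delta function at
  -- `0`, and `ψ(±q)` become multiples of `ψ(∓q)` by the shifted Gauss sums.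
  have hg (n : ZMod 3) : typeComp n τ = etaB τ / 3 +
      (-3 * etaA τ + (etaB τ + 3 * etaA τ) * ψ 1) / 3 * ψ n +
      (-3 * etaA τ + (etaB τ + 3 * etaA τ) * ψ 2) / 3 * ψ (-n) := by
    rcases zmod3_cases n with rfl | rfl | rfl
    · rw [typeComp_zero, neg_zero, AddChar.map_zero_eq_one]
      linear_combination (-(etaB τ + 3 * etaA τ) / 3) * p1
    · rw [typeComp_one, n1, p2]
      rw [p2] at p1
      linear_combination (-etaB τ / 3) * p1 - (etaB τ + 3 * etaA τ) / 3 * ψ 1 * p3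
    · rw [typeComp_two, n2, p2]
      rw [p2] at p1
      linear_combination etaA τ * p1 - (etaB τ + 3 * etaA τ) * 2 / 3 * p3
  have s0 : ∑ δ, ψ (-b δ γ) * (if δ = 0 then 27 * etaA τ else 0) = 27 * etaA τ := by
    rw [Finset.sum_eq_single 0 (fun δ _ hδ => by simp [hδ]) (by simp), h.b_comm, h.b_zero]
    simp
  have s1 : ∑ δ, ψ (-b δ γ) = if γ = 0 then 243 else 0 := by
    have := h.sum_b (-γ)
    simp only [h.b_neg, neg_eq_zero] at this
    exact this
  have s2 := h.gauss_shift γ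
  have s3 := h.gauss_neg_shift γ
  have hsum : ∑ δ, ψ (-b δ γ) * discComp q δ τ = 27 * etaA τ +
      (etaB τ / 3 * (if γ = 0 then 243 else 0) +
      (-3 * etaA τ + (etaB τ + 3 * etaA τ) * ψ 1) / 3 * (9 * rootNegThree * ψ (-q γ)) +
      (-3 * etaA τ + (etaB τ + 3 * etaA τ) * ψ 2) / 3 * (-9 * rootNegThree * ψ (q γ))) := by
    rw [← s1, ← s2, ← s3, ← s0, Finset.mul_sum, Finset.mul_sum, Finset.mul_sum,
      ← Finset.sum_add_distrib, ← Finset.sum_add_distrib, ← Finset.sum_add_distrib]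
    refine Finset.sum_congr rfl fun δ _ => ?_
    rw [discComp, hg, sub_eq_add_neg, sub_eq_add_neg, AddChar.map_add_eq_mul,
      AddChar.map_add_eq_mul]
    ring
  -- The constant Fourier coefficient `etaB τ / 3` accounts exactly for the extra component at `0`;
  -- this fixes the coefficient `27`.
  have hA : (if γ = 0 then 27 * etaA (ModularGroup.S • τ) else 0) =
      ((τ : ℂ) ^ 3)⁻¹ * (-rootNegThree / 27 * (etaB τ / 3 * (if γ = 0 then 243 else 0))) := by
    split_ifs
    · rw [etaA_S]
      ring
    · simp
  rw [opS_apply, hsum, discComp, hA]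
  rcases zmod3_cases (q γ) with h | h | h <;> rw [h]
  · rw [typeComp_zero, etaA_S, neg_zero, AddChar.map_zero_eq_one]
    linear_combination ((τ : ℂ) ^ 3)⁻¹ * (etaB τ + 3 * etaA τ) *
      (rootNegThree / 9 * hr2 - rootNegThree ^ 2 / 9 * hr)
  · rw [typeComp_one, n1]
    linear_combination ((τ : ℂ) ^ 3)⁻¹ * etaA τ *
      (rootNegThree / 3 * hr2 - rootNegThree ^ 2 / 3 * hr)
  · rw [typeComp_two, etaA_S, etaB_S, n2]
    have p4 : ψ 2 ^ 2 = ψ 1 := by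
      rw [p2]
      linear_combination ψ 1 * p3
    linear_combination ((τ : ℂ) ^ 3)⁻¹ * ((2 * etaA τ + etaB τ / 3) *
      (-rootNegThree / 3 * hr2 + rootNegThree ^ 2 / 3 * hr) +
      rootNegThree ^ 2 / 9 * (etaB τ + 3 * etaA τ) * (-p2 - p4))

end Transform

end CubicForm

namespace CubicForm

open Filter Topology

/-! ### Modularity -/

theorem autFactor_ne_zero (g : SL(2, ℤ)) (τ : ℍ) : autFactor g τ ≠ 0 := by
  have := UpperHalfPlane.denom_ne_zero (g : GL (Fin 2) ℝ) τ
  rwa [ModularGroup.denom_apply] at this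

theorem autFactor_mul (g h : SL(2, ℤ)) (τ : ℍ) :
    autFactor (g * h) τ = autFactor g (h • τ) * autFactor h τ := by
  have hne := autFactor_ne_zero h τ
  have hc : ((h • τ : ℍ) : ℂ) = (((h 0 0 : ℤ) : ℂ) * τ + ((h 0 1 : ℤ) : ℂ)) / autFactor h τ := by
    rw [UpperHalfPlane.coe_specialLinearGroup_apply]
    simp [autFactor]
  rw [autFactor, autFactor, hc]
  field_simp
  simp only [autFactor, Matrix.SpecialLinearGroup.coe_mul, Matrix.mul_apply, Fin.sum_univ_two]
  push_cast
  ring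

/-- By the cocycle relation `autFactor_mul`, the transformation law passes to products and inverses.
-/
theorem transform_of_generators {D : Type*} (k : ℤ) (ρ : Representation ℂ SL(2, ℤ) (D → ℂ))
    (f : D → ℍ → ℂ)
    (hS : ∀ τ γ, f γ (ModularGroup.S • τ) =
      autFactor ModularGroup.S τ ^ k * ρ ModularGroup.S (fun δ => f δ τ) γ)
    (hT : ∀ τ γ, f γ (ModularGroup.T • τ) =
      autFactor ModularGroup.T τ ^ k * ρ ModularGroup.T (fun δ => f δ τ) γ)
    (g : SL(2, ℤ)) : ∀ (τ : ℍ) (γ : D),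
      f γ (g • τ) = autFactor g τ ^ k * ρ g (fun δ => f δ τ) γ := by
  have hg : g ∈ Subgroup.closure {ModularGroup.S, ModularGroup.T} := by
    simp [SpecialLinearGroup.SL2Z_generators]
  have h1 (τ : ℍ) : autFactor 1 τ = 1 := by simp [autFactor]
  induction hg using Subgroup.closure_induction with
  | mem x hx =>
    rcases hx with rfl | rfl
    · exact hS
    · exact hT
  | one => simp [h1]
  | mul x y _ _ hx hy =>
    intro τ γ
    have : (fun δ => f δ (y • τ)) = autFactor y τ ^ k • ρ y (fun δ => f δ τ) := funext fun δ =>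
      hy τ δ
    rw [mul_smul, hx, this, map_smul, map_mul, Module.End.mul_apply, autFactor_mul, mul_zpow,
      Pi.smul_apply, smul_eq_mul, mul_assoc]
  | inv x _ hx =>
    intro τ γ
    have h2 : (fun δ => f δ τ) =
        autFactor x (x⁻¹ • τ) ^ k • ρ x (fun δ => f δ (x⁻¹ • τ)) := funext fun δ => by
      have := hx (x⁻¹ • τ) δ
      rwa [smul_inv_smul] at this
    have h3 : autFactor x⁻¹ τ * autFactor x (x⁻¹ • τ) = 1 := by
      rw [mul_comm, ← autFactor_mul, mul_inv_cancel, h1]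
    rw [h2, map_smul, ← Module.End.mul_apply, ← map_mul, inv_mul_cancel, map_one,
      Module.End.one_apply, Pi.smul_apply, smul_eq_mul, ← mul_assoc, ← mul_zpow, h3, one_zpow,
      one_mul]

/-- After the automorphy factors cancel, what remains is `ρ(g)` applied to the vector of components.
Its entries are constant combinations of functions of `e^{2πiτ/3}`, so `N = 3` serves every cusp. -/
theorem meromorphicAtImInfty_of_localParam {D : Type*} [Fintype D] (k : ℤ)
    (ρ : Representation ℂ SL(2, ℤ) (D → ℂ)) (f : D → ℍ → ℂ)
    (h : ∀ (g : SL(2, ℤ)) (τ : ℍ) (γ : D),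
      f γ (g • τ) = autFactor g τ ^ k * ρ g (fun δ => f δ τ) γ)
    (F : D → ℂ → ℂ) (hF : ∀ γ, MeromorphicAt (F γ) 0) (hf : ∀ γ τ, f γ τ = F γ (localParam τ))
    (g : SL(2, ℤ)) (γ : D) : MeromorphicAtImInfty fun τ => autFactor g τ ^ (-k) * f γ (g • τ) := by
  classical
  refine ⟨3, by norm_num, fun x => ∑ δ, F δ x * ρ g (Pi.single δ 1) γ,
    MeromorphicAt.fun_sum fun δ _ => (hF δ).mul (MeromorphicAt.const _ 0), .of_forall fun τ => ?_⟩
  beta_reduce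
  rw [h, ← mul_assoc, ← zpow_add₀ (autFactor_ne_zero g τ), neg_add_cancel, zpow_zero, one_mul,
    LinearMap.pi_apply_eq_sum_univ (ρ g), Finset.sum_apply]
  refine Finset.sum_congr rfl fun δ _ => ?_
  have he : (fun j => if δ = j then (1 : ℂ) else 0) = Pi.single δ 1 := by
    funext i
    simp [Pi.single_apply, eq_comm]
  rw [Pi.smul_apply, smul_eq_mul, hf, localParam, he]
  rfl

/-- The function of the local parameter `e^{2πiτ/3}` given by a component of the form. -/
noncomputable def localA (x : ℂ) : ℂ := euler (x ^ 9) ^ 3 * (euler (x ^ 3) ^ 9)⁻¹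

/-- The function of the local parameter `e^{2πiτ/3}` given by the component of type `2`. -/
noncomputable def localC (x : ℂ) : ℂ := x⁻¹ * (dissect x * (euler (x ^ 3) ^ 9)⁻¹)

theorem analyticAt_euler_pow {n : ℕ} (hn : n ≠ 0) : AnalyticAt ℂ (fun x => euler (x ^ n)) 0 :=
  AnalyticAt.fun_comp (g := euler) (by simpa [hn] using analyticAt_euler) (by fun_prop)

theorem meromorphicAt_localA : MeromorphicAt localA 0 :=
  ((analyticAt_euler_pow (by norm_num)).meromorphicAt.pow 3).mul
    ((analyticAt_euler_pow (by norm_num)).meromorphicAt.pow 9).inv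

theorem meromorphicAt_localC : MeromorphicAt localC 0 := by
  have h1 : MeromorphicAt (fun x : ℂ => x) 0 := analyticAt_id.meromorphicAt
  have h2 : MeromorphicAt dissect 0 :=
    (analyticAt_euler.meromorphicAt.pow 3).add (((MeromorphicAt.const 3 0).mul h1).mul
      ((analyticAt_euler_pow (by norm_num)).meromorphicAt.pow 3))
  exact h1.inv.mul (h2.mul ((analyticAt_euler_pow (by norm_num)).meromorphicAt.pow 9).inv)

theorem mdifferentiable_etaA : MDifferentiable 𝓘(ℂ) 𝓘(ℂ) etaA := by
  rw [UpperHalfPlane.mdifferentiable_iff]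
  have h : DifferentiableOn ℂ (fun z : ℂ => ModularForm.eta (3 * z) ^ 3 *
      ModularForm.eta z ^ (-9 : ℤ)) {z | 0 < z.im} := by
    intro z hz
    have h3 : 0 < (3 * z).im := by
      rw [show 3 * z = ((3 : ℝ) : ℂ) * z by push_cast; ring, im_ofReal_mul]
      exact mul_pos (by norm_num) hz
    have d1 := ModularForm.differentiableAt_eta_of_mem_upperHalfPlaneSet hz
    have d2 : DifferentiableAt ℂ (fun z : ℂ => ModularForm.eta (3 * z)) z :=
      DifferentiableAt.comp (g := ModularForm.eta) z
        (ModularForm.differentiableAt_eta_of_mem_upperHalfPlaneSet h3) (by fun_prop)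
    exact ((d2.pow 3).mul (d1.zpow (Or.inl (ModularForm.eta_ne_zero hz)))).differentiableWithinAt
  refine h.congr fun z hz => ?_
  simp [etaA, UpperHalfPlane.ofComplex_apply_of_im_pos hz]

theorem mdifferentiable_etaB : MDifferentiable 𝓘(ℂ) 𝓘(ℂ) etaB := by
  rw [UpperHalfPlane.mdifferentiable_iff]
  have h : DifferentiableOn ℂ (fun z : ℂ => ModularForm.eta (z / 3) ^ 3 *
      ModularForm.eta z ^ (-9 : ℤ)) {z | 0 < z.im} := by
    intro z hz
    have h3 : 0 < (z / 3).im := by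
      rw [show z / 3 = ((1 / 3 : ℝ) : ℂ) * z by push_cast; ring, im_ofReal_mul]
      exact mul_pos (by norm_num) hz
    have d1 := ModularForm.differentiableAt_eta_of_mem_upperHalfPlaneSet hz
    have d2 : DifferentiableAt ℂ (fun z : ℂ => ModularForm.eta (z / 3)) z :=
      DifferentiableAt.comp (g := ModularForm.eta) z
        (ModularForm.differentiableAt_eta_of_mem_upperHalfPlaneSet h3) (by fun_prop)
    exact ((d2.pow 3).mul (d1.zpow (Or.inl (ModularForm.eta_ne_zero hz)))).differentiableWithinAt
  refine h.congr fun z hz => ?_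
  simp [etaB, UpperHalfPlane.ofComplex_apply_of_im_pos hz]

theorem isModularFormOfType_discComp {D : Type*} [AddCommGroup D] [Fintype D] [DecidableEq D]
    {q : D → ZMod 3} {b : D → D → ZMod 3} (h : IsDiscForm q b)
    {ρ : Representation ℂ SL(2, ℤ) (D → ℂ)} (hS : ρ ModularGroup.S = opS b)
    (hT : ρ ModularGroup.T = opT q) : IsModularFormOfType (-3) ρ (discComp q) := by
  have ht := transform_of_generators (-3) ρ (discComp q)
    (fun τ γ => by
      rw [discComp_S h, hS, show autFactor ModularGroup.S τ = τ by
        simp [autFactor, ModularGroup.coe_S]]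
      rfl)
    (fun τ γ => by
      rw [discComp_T h, hT, show autFactor ModularGroup.T τ = 1 by
        simp [autFactor, ModularGroup.coe_T], one_zpow, one_mul])
  refine ⟨fun γ => ?_, ht, ?_⟩
  · have h0 : MDifferentiable 𝓘(ℂ) 𝓘(ℂ) fun _ : ℍ => (0 : ℂ) := mdifferentiable_const
    refine MDifferentiable.add (f := fun τ => if γ = 0 then 27 * etaA τ else 0)
      (g := typeComp (q γ)) ?_ ?_
    · split_ifs
      · exact mdifferentiable_etaA.const_smul (27 : ℂ)
      · exact h0
    · unfold typeComp
      split_ifs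
      · exact mdifferentiable_etaA.const_smul (-3 : ℂ)
      · exact h0
      · exact mdifferentiable_etaB.add (mdifferentiable_etaA.const_smul (3 : ℂ))
  · refine meromorphicAtImInfty_of_localParam (-3) ρ _ ht
      (fun γ x => (if γ = 0 then 27 * localA x else 0) +
        if q γ = 0 then -3 * localA x else if q γ = 1 then 0 else localC x) (fun γ => ?_)
      fun γ τ => ?_
    · refine MeromorphicAt.fun_add ?_ ?_ <;> split_ifs
      · exact (MeromorphicAt.const _ _).mul meromorphicAt_localA
      · exact MeromorphicAt.const _ _
      · exact (MeromorphicAt.const _ _).mul meromorphicAt_localA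
      · exact MeromorphicAt.const _ _
      · exact meromorphicAt_localC
    · rw [discComp, typeComp, etaB_add_eq, etaA_eq]
      rfl

/-! ### Expansions at `i∞` -/

theorem tendsto_localParam : Tendsto localParam UpperHalfPlane.atImInfty (𝓝 0) := by
  have h := UpperHalfPlane.qParam_tendsto_atImInfty (h := 3) (by norm_num)
  refine h.congr fun τ => ?_
  simp [Function.Periodic.qParam, localParam]

theorem qPow_eq (n : ℤ) {r : ℝ} (hr : 3 * r = n) (τ : ℍ) : qPow r τ = localParam τ ^ n := by
  rw [qPow, localParam, ← exp_int_mul]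
  congr 1
  have : (n : ℂ) = 3 * r := by
    rw [← ofReal_intCast, ← hr]
    push_cast
    ring
  rw [this]
  ring

theorem etaA_isBigO : (fun τ => etaA τ - (1 + 9 * qPow 1 τ + 54 * qPow 2 τ))
    =O[UpperHalfPlane.atImInfty] qPow 3 := by
  have ht : Tendsto (fun τ => localParam τ ^ 3) UpperHalfPlane.atImInfty (𝓝 0) := by
    simpa using tendsto_localParam.pow 3
  refine (euler_quot_isBigO.comp_tendsto ht).congr (fun τ => ?_) fun τ => ?_
  · rw [qPow_eq 3 (by norm_num), qPow_eq 6 (by norm_num), etaA_eq]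
    simp only [Function.comp, ← pow_mul]
    rfl
  · rw [qPow_eq 9 (by norm_num)]
    simp only [Function.comp, ← pow_mul]
    rfl

theorem qPow_isBigO {r s : ℝ} (h : s ≤ r) : qPow r =O[UpperHalfPlane.atImInfty] qPow s := by
  refine IsBigO.of_bound 1 (.of_forall fun τ => ?_)
  have e (r : ℝ) : ‖qPow r τ‖ = Real.exp (-(2 * Real.pi * r * τ.im)) := by
    rw [qPow, norm_exp]
    congr 1
    rw [show 2 * Real.pi * I * r * (τ : ℂ) = ((2 * Real.pi * r : ℝ) : ℂ) * (I * τ) by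
      push_cast; ring, re_ofReal_mul]
    simp
  rw [e, e, one_mul, Real.exp_le_exp]
  have := mul_le_mul_of_nonneg_left h (mul_pos Real.pi_pos τ.im_pos).le
  linarith

theorem etaA_sub_one_isBigO : (fun τ => etaA τ - 1) =O[UpperHalfPlane.atImInfty] qPow 1 := by
  have h1 := etaA_isBigO.trans (qPow_isBigO (show (1 : ℝ) ≤ 3 by norm_num))
  have h2 := (qPow_isBigO (le_refl (1 : ℝ))).const_mul_left 9
  have h3 := (qPow_isBigO (show (1 : ℝ) ≤ 2 by norm_num)).const_mul_left 54
  refine ((h1.add h2).add h3).congr_left fun τ => ?_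
  ring

theorem etaB_add_isBigO : (fun τ => etaB τ + 3 * etaA τ -
    (qPow (-1 / 3) τ + 14 * qPow (2 / 3) τ + 92 * qPow (5 / 3) τ))
    =O[UpperHalfPlane.atImInfty] qPow (8 / 3) := by
  have h := (isBigO_refl (fun τ => (localParam τ)⁻¹) UpperHalfPlane.atImInfty).mul
    (dissect_isBigO.comp_tendsto tendsto_localParam)
  refine h.congr (fun τ => ?_) fun τ => ?_
  · have hx := localParam_ne_zero τ
    rw [qPow_eq (-1) (by norm_num), qPow_eq 2 (by norm_num), qPow_eq 5 (by norm_num), etaB_add_eq,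
      zpow_neg_one, show (2 : ℤ) = (2 : ℕ) from rfl, show (5 : ℤ) = (5 : ℕ) from rfl, zpow_natCast,
      zpow_natCast]
    simp only [Function.comp]
    generalize dissect (localParam τ) * (euler (localParam τ ^ 3) ^ 9)⁻¹ = u
    field_simp
  · have hx := localParam_ne_zero τ
    rw [qPow_eq 8 (by norm_num), show (8 : ℤ) = (8 : ℕ) from rfl, zpow_natCast]
    simp only [Function.comp]
    field_simp

/-! ### The main theorem -/

theorem psi_intCast (m : ℤ) : ψ (m : ZMod 3) = exp (2 * Real.pi * I * m / 3) := by
  rw [ZMod.stdAddChar_coe]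
  norm_num

theorem f00_eq (τ : ℍ) : f00 τ = 24 * etaA τ := mul_assoc _ _ _

theorem f0_eq (τ : ℍ) : f0 τ = -3 * etaA τ := mul_assoc _ _ _

theorem f2_eq (τ : ℍ) : f2 τ = etaB τ + 3 * etaA τ := by
  rw [f2, etaA, etaB, mul_assoc 3]

section Main

variable {V : Type*} [AddCommGroup V] [Module ℚ V] {B : LinearMap.BilinForm ℚ V}
  {M : Submodule ℤ V}

theorem hasType_iff {γ : Disc B M} {c : ZMod 3}
    (h : ∃ m : ℤ, pairing γ γ / 2 = m / 3 ∧ (m : ZMod 3) = c) (n : ℕ) :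
    HasType γ n ↔ γ ≠ 0 ∧ c = n := by
  obtain ⟨m, hm, rfl⟩ := h
  refine and_congr_right fun _ => ?_
  rw [hm, show ((n : ℕ) : ZMod 3) = ((n : ℤ) : ZMod 3) by push_cast; rfl,
    ZMod.intCast_eq_intCast_iff_dvd_sub]
  constructor
  · rintro ⟨k, hk⟩
    refine ⟨-k, ?_⟩
    have : (m : ℚ) = n + 3 * k := by linarith
    have : m = n + 3 * k := by exact_mod_cast this
    rw [this]
    push_cast
    ring
  · rintro ⟨k, hk⟩
    refine ⟨-k, ?_⟩
    have : (m : ℚ) = n - 3 * k := by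
      have : m = n - 3 * k := by
        push_cast at hk
        linarith
      exact_mod_cast this
    rw [this]
    push_cast
    ring

/-- The exponentials depend only on `3 · γ²/2` and `3(δ, γ)` modulo `3`, hence are values of `ψ`. -/
theorem isWeilRep_iff [Fintype (Disc B M)] {q : Disc B M → ZMod 3}
    {b : Disc B M → Disc B M → ZMod 3}
    (hq : ∀ γ, ∃ m : ℤ, pairing γ γ / 2 = m / 3 ∧ (m : ZMod 3) = q γ)
    (hb : ∀ γ δ, ∃ m : ℤ, pairing γ δ = m / 3 ∧ (m : ZMod 3) = b γ δ)
    (ρ : Representation ℂ SL(2, ℤ) (Disc B M → ℂ)) :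
    IsWeilRep ρ ↔ ρ ModularGroup.S = opS b ∧ ρ ModularGroup.T = opT q := by
  have hq' (γ) : exp (Real.pi * I * (pairing γ γ : ℚ)) = ψ (q γ) := by
    obtain ⟨m, hm, h⟩ := hq γ
    rw [← h, psi_intCast, show pairing γ γ = 2 * (m / 3) by rw [← hm]; ring]
    push_cast
    ring_nf
  have hb' (δ γ) : exp (-(2 * Real.pi * I * (pairing δ γ : ℚ))) = ψ (-b δ γ) := by
    obtain ⟨m, hm, h⟩ := hb δ γ
    rw [← h, ← Int.cast_neg, psi_intCast, hm]
    push_cast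
    ring_nf
  rw [IsWeilRep, and_comm]
  simp only [hq', hb', weil_const, finsum_eq_sum_of_fintype]
  refine and_congr ⟨fun h => LinearMap.ext fun φ => funext fun γ => h φ γ, fun h φ γ => ?_⟩
    ⟨fun h => LinearMap.ext fun φ => funext fun γ => h φ γ, fun h φ γ => ?_⟩
  · rw [h, opS_apply]
  · rw [h, opT_apply]

open Classical in
-- At `γ = 0`, where `q` vanishes, `27 - 3 = 24` gives the coefficient of `f00`.
theorem form_eq_discComp {q : Disc B M → ZMod 3}
    (hq : ∀ γ, ∃ m : ℤ, pairing γ γ / 2 = m / 3 ∧ (m : ZMod 3) = q γ) (h0 : q 0 = 0) :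
    form B M = discComp q := by
  funext γ τ
  unfold form discComp
  simp only [hasType_iff (hq γ)]
  by_cases hγ : γ = 0
  · subst hγ
    rw [if_pos rfl, if_pos rfl, h0, typeComp_zero, f00_eq]
    ring
  · simp only [hγ, if_false, ne_eq, not_false_iff, true_and, zero_add]
    push_cast
    rcases zmod3_cases (q γ) with h | h | h <;> rw [h]
    · rw [if_pos rfl, typeComp_zero, f0_eq]
    · rw [if_neg (by decide), if_pos rfl, typeComp_one, f1]
    · rw [if_neg (by decide), if_neg (by decide), if_pos rfl, typeComp_two, f2_eq]

end Main

end CubicForm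

theorem mainTheorem2 {V : Type*} [AddCommGroup V] [Module ℚ V]
    (B : LinearMap.BilinForm ℚ V) (M : Submodule ℤ V) (hM : CubicForm.IsA2A2 B M) :
    -- the discriminant group has order `3⁵`, and its nonzero elements have exactly one type
    Nat.card (CubicForm.Disc B M) = 3 ^ 5 ∧
    (∀ γ : CubicForm.Disc B M, γ ≠ 0 → ∃! n : ℕ, n < 3 ∧ CubicForm.HasType γ n) ∧
    -- the Weil representation exists, and `f` is a modular form of weight `-3` of this type
    (∃! ρ : Representation ℂ SL(2, ℤ) (CubicForm.Disc B M → ℂ), CubicForm.IsWeilRep ρ) ∧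
    (∀ ρ : Representation ℂ SL(2, ℤ) (CubicForm.Disc B M → ℂ), CubicForm.IsWeilRep ρ →
      CubicForm.IsModularFormOfType (-3) ρ (CubicForm.form B M)) ∧
    -- the expansions at `i∞`
    ((fun τ => CubicForm.f00 τ -
        24 * (1 + 9 * CubicForm.qPow 1 τ + 54 * CubicForm.qPow 2 τ))
      =O[UpperHalfPlane.atImInfty] CubicForm.qPow 3) ∧
    ((fun τ => CubicForm.f0 τ - (-3)) =O[UpperHalfPlane.atImInfty] CubicForm.qPow 1) ∧
    ((fun τ => CubicForm.f2 τ - (CubicForm.qPow (-1 / 3) τ + 14 * CubicForm.qPow (2 / 3) τ +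
        92 * CubicForm.qPow (5 / 3) τ))
      =O[UpperHalfPlane.atImInfty] CubicForm.qPow (8 / 3)) := by
  classical
  obtain ⟨e, hq, hb⟩ := CubicForm.exists_disc_equiv hM
  let _ : Fintype (CubicForm.Disc B M) := Fintype.ofEquiv _ e.symm.toEquiv
  have hD := CubicForm.isDiscForm_std.comp e
  have hW := CubicForm.isWeilRep_iff hq hb
  refine ⟨?_, fun γ hγ => ?_, ?_, fun ρ hρ => ?_, ?_, ?_, ?_⟩
  · rw [Nat.card_congr e.toEquiv, Nat.card_eq_fintype_card]
    simp
  · simp only [CubicForm.hasType_iff (hq γ)]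
    refine ⟨(CubicForm.stdQ (e γ)).val, ⟨ZMod.val_lt _, hγ, by simp⟩, ?_⟩
    rintro n ⟨hn, -, h⟩
    rw [h, ZMod.val_natCast_of_lt hn]
  · obtain ⟨ρ, hS, hT⟩ := CubicForm.exists_weilRep hD
    refine ⟨ρ, (hW ρ).mpr ⟨hS, hT⟩, fun σ hσ => ?_⟩
    obtain ⟨hS', hT'⟩ := (hW σ).mp hσ
    exact CubicForm.rep_ext (hS'.trans hS.symm) (hT'.trans hT.symm)
  · obtain ⟨hS, hT⟩ := (hW ρ).mp hρ
    rw [CubicForm.form_eq_discComp hq hD.q_zero]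
    exact CubicForm.isModularFormOfType_discComp hD hS hT
  · refine (CubicForm.etaA_isBigO.const_mul_left 24).congr_left fun τ => ?_
    rw [CubicForm.f00_eq]
    ring
  · refine (CubicForm.etaA_sub_one_isBigO.const_mul_left (-3)).congr_left fun τ => ?_
    rw [CubicForm.f0_eq]
    ring
  · simp only [CubicForm.f2_eq]
    exact CubicForm.etaB_add_isBigO
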